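/- Let $V:(0,\infty)\to\mathbb C$ be a measurable potential such that $\int_0^\infty e^{ax}|V(x)|\,dx<\infty$ for a certain real $a$, put $$b=\frac1{\ln 2}\int_0^\infty |V(x)|\,dx ,$$ and assume $a\ge b$. Let $L_V=-d^2/dx^2+V(x)$ be the operator in $L_2(0,\infty)$ with Dirichlet boundary condition at zero: its domain consists of the $y\in L_2(0,\infty)$ such that $y,y'$ are locally absolutely continuous on $[0,\infty)$, $y(0)=0$ and $-y''+Vy\in L_2(0,\infty)$. For $\operatorname{Im}k>-a/2$, or $\operatorname{Im}k\ge 0$, let $e(x,k)=e^{ikx}\sum_{n\ge0}\varepsilon^{(n)}(x,k)$, where $\varepsilon^{(0)}=1$ and $$\varepsilon^{(n+1)}(x,k)=\int_x^\infty\frac{e^{2ik(\xi-x)}-1}{2ik}\,V(\xi)\,\varepsilon^{(n)}(\xi,k)\,d\xi$$ (the quotient being $\xi-x$ for $k=0$), be the Jost solution of $-y''+Vy=k^2y$, with $e(x,k)\sim e^{ikx}$ as $x\to\infty$, and let $e(k)=e(0,k)$ be the Jost function. The spectral singularities of $L_V$ are the points $\lambda=k^2$ given by the real zeros $k$ of $e$.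 Let $N(V)$ be the total multiplicity of eigenvalues and spectral singularities of $L_V$, that is, the sum over all eigenvalues $\lambda$ of $L_V$ of the algebraic multiplicity $\dim\bigcup_n\ker(L_V-\lambda)^n$, plus the sum over all real zeros $k$ of the Jost function of the order of the zero. Then $$N(V)\ \le\ 10\left\{1+\frac2b\int_0^\infty e^{bx}|V(x)|\,dx\right\}$$ (in particular $N(V)$ is finite). If $b=0$, i.e. $V=0$ almost everywhere, the term with $2/b$ is read as $0$. -/

import Mathlib

open MeasureTheory Set
open scoped ENNReal

noncomputable section

namespace HalfLineSchrodinger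

/-- The Hilbert space `L²(0, ∞)` of complex-valued functions. -/
abbrev HalfLineL2 : Type := Lp ℂ 2 (volume.restrict (Ioi (0 : ℝ)))

/-- `IsDirichletPair V u f` says that `u` lies in the domain of the Dirichlet operator
`L_V = -d²/dx² + V` on `L²(0, ∞)` and that `L_V u = f`: the class `u` has a representative `y`
which is continuously differentiable on `[0, ∞)`, with `y 0 = 0`, whose derivative `z` is locally
absolutely continuous, and `-y'' + V y = f`. The last two requirements are expressed by saying that
`z` is an indefinite integral of the locally integrable function `V y - f`. -/
def IsDirichletPair (V : ℝ → ℂ) (u f : HalfLineL2) : Prop :=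
  ∃ y z : ℝ → ℂ,
    (∀ᵐ x ∂(volume.restrict (Ioi (0 : ℝ))), u x = y x) ∧
    y 0 = 0 ∧
    (∀ x : ℝ, 0 ≤ x → HasDerivWithinAt y (z x) (Ici 0) x) ∧
    (∀ x : ℝ, 0 ≤ x → IntervalIntegrable (fun t => V t * y t) volume 0 x) ∧
    (∀ x : ℝ, 0 ≤ x → z x = z 0 + ∫ t in (0 : ℝ)..x, (V t * y t - f t))

theorem intervalIntegrable_coe (f : HalfLineL2) (x : ℝ) (hx : 0 ≤ x) :
    IntervalIntegrable (fun t => f t) volume 0 x := by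
  rw [intervalIntegrable_iff_integrableOn_Ioc_of_le hx]
  have h : MemLp (fun t => f t) 2 (volume.restrict (Ioc 0 x)) :=
    (Lp.memLp f).mono_measure (Measure.restrict_mono Ioc_subset_Ioi_self le_rfl)
  exact h.integrable (by norm_num)

theorem integral_congr_halfLine {f g : ℝ → ℂ}
    (h : ∀ᵐ t ∂(volume.restrict (Ioi (0 : ℝ))), f t = g t) (x : ℝ) (hx : 0 ≤ x) :
    ∫ t in (0 : ℝ)..x, f t = ∫ t in (0 : ℝ)..x, g t := by
  rw [intervalIntegral.integral_of_le hx, intervalIntegral.integral_of_le hx]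
  exact integral_congr_ae
    (ae_mono (Measure.restrict_mono Ioc_subset_Ioi_self le_rfl) h)

/-- The graph of `L_V`, a linear subspace of `L²(0, ∞) × L²(0, ∞)`. -/
def dirichletGraph (V : ℝ → ℂ) : Submodule ℂ (HalfLineL2 × HalfLineL2) where
  carrier := {p | IsDirichletPair V p.1 p.2}
  zero_mem' := by
    refine ⟨fun _ => 0, fun _ => 0, Lp.coeFn_zero _ _ _, rfl,
      fun x _ => hasDerivWithinAt_const _ _ _, fun x _ => by simp, fun x hx => ?_⟩
    have h : ∀ᵐ t ∂(volume.restrict (Ioi (0 : ℝ))),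
        V t * 0 - ((0 : HalfLineL2) : ℝ → ℂ) t = (fun _ => (0 : ℂ)) t := by
      filter_upwards [Lp.coeFn_zero ℂ 2 (volume.restrict (Ioi (0 : ℝ)))] with t ht
      rw [ht]; simp
    have := integral_congr_halfLine h x hx
    simpa using this.symm
  add_mem' := by
    rintro ⟨u₁, f₁⟩ ⟨u₂, f₂⟩ ⟨y₁, z₁, hu₁, h0₁, hd₁, hi₁, hz₁⟩ ⟨y₂, z₂, hu₂, h0₂, hd₂, hi₂, hz₂⟩
    refine ⟨fun x => y₁ x + y₂ x, fun x => z₁ x + z₂ x, ?_, by simp [h0₁, h0₂],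
      fun x hx => (hd₁ x hx).add (hd₂ x hx), fun x hx => ?_, fun x hx => ?_⟩
    · filter_upwards [Lp.coeFn_add u₁ u₂, hu₁, hu₂] with t ht h1 h2
      exact ht.trans (congrArg₂ (· + ·) h1 h2)
    · simpa [mul_add] using (hi₁ x hx).add (hi₂ x hx)
    · have h : ∀ᵐ t ∂(volume.restrict (Ioi (0 : ℝ))),
          V t * (y₁ t + y₂ t) - ((f₁ + f₂ : HalfLineL2) : ℝ → ℂ) t
            = (V t * y₁ t - f₁ t) + (V t * y₂ t - f₂ t) := by
        filter_upwards [Lp.coeFn_add f₁ f₂] with t ht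
        rw [ht, Pi.add_apply]; ring
      have h' := integral_congr_halfLine h x hx
      rw [intervalIntegral.integral_add
        ((hi₁ x hx).sub (intervalIntegrable_coe f₁ x hx))
        ((hi₂ x hx).sub (intervalIntegrable_coe f₂ x hx))] at h'
      simp only [Prod.mk_add_mk]
      rw [h', hz₁ x hx, hz₂ x hx]; ring
  smul_mem' := by
    rintro c ⟨u, f⟩ ⟨y, z, hu, h0, hd, hi, hz⟩
    refine ⟨fun x => c * y x, fun x => c * z x, ?_, by simp [h0],
      fun x hx => (hd x hx).const_mul c, fun x hx => ?_, fun x hx => ?_⟩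
    · filter_upwards [Lp.coeFn_smul c u, hu] with t ht h1
      simp [ht, h1]
    · simpa [mul_left_comm] using (hi x hx).const_mul c
    · have h : ∀ᵐ t ∂(volume.restrict (Ioi (0 : ℝ))),
          V t * (c * y t) - ((c • f : HalfLineL2) : ℝ → ℂ) t = c * (V t * y t - f t) := by
        filter_upwards [Lp.coeFn_smul c f] with t ht
        simp [ht]; ring
      have h' := integral_congr_halfLine h x hx
      rw [intervalIntegral.integral_const_mul] at h'
      simp only [Prod.smul_mk]
      rw [h', hz x hx]; ring

/-- The graph is single-valued. -/
theorem dirichletGraph_functional (V : ℝ → ℂ) (p : HalfLineL2 × HalfLineL2)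
    (hp : p ∈ dirichletGraph V) (h1 : p.1 = 0) : p.2 = 0 := by
  obtain ⟨u, f⟩ := p
  obtain ⟨y, z, hu, h0, hd, hi, hz⟩ := hp
  simp only at h1 hu hz ⊢
  subst h1
  have hy0 : y =ᵐ[volume.restrict (Ioi (0 : ℝ))] fun _ => (0 : ℂ) := by
    filter_upwards [hu, Lp.coeFn_zero ℂ 2 (volume.restrict (Ioi (0 : ℝ)))] with t h1 h2
    rw [← h1, h2]; rfl
  have hyc : ContinuousOn y (Ioi 0) := fun x hx =>
    ((hd x (le_of_lt hx)).continuousWithinAt).mono Ioi_subset_Ici_self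
  have hy : ∀ x, 0 ≤ x → y x = 0 := by
    intro x hx
    rcases hx.eq_or_lt with rfl | hx
    · exact h0
    · exact Measure.eqOn_open_of_ae_eq hy0 isOpen_Ioi hyc continuousOn_const hx
  have hzz : ∀ x, 0 ≤ x → z x = 0 := by
    intro x hx
    have h2 : HasDerivWithinAt y 0 (Ici 0) x :=
      (hasDerivWithinAt_const x (Ici (0 : ℝ)) (0 : ℂ)).congr (fun t ht => hy t ht) (hy x hx)
    exact (uniqueDiffOn_Ici (0 : ℝ) x hx).eq_deriv _ (hd x hx) h2
  have hint : ∀ x, 0 ≤ x → ∫ t in (0 : ℝ)..x, f t = 0 := by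
    intro x hx
    have h := hz x hx
    rw [hzz x hx, hzz 0 le_rfl, zero_add] at h
    have h' : ∀ᵐ t ∂(volume.restrict (Ioi (0 : ℝ))), V t * y t - f t = - f t := by
      filter_upwards [hy0] with t ht
      simp [ht]
    rw [integral_congr_halfLine h' x hx, intervalIntegral.integral_neg] at h
    exact neg_eq_zero.mp h.symm
  have hG : LocallyIntegrable ((Ioi (0 : ℝ)).indicator (fun t => f t)) volume := by
    have h2 : MemLp ((Ioi (0 : ℝ)).indicator (fun t => f t)) 2 volume :=
      (memLp_indicator_iff_restrict measurableSet_Ioi).2 (Lp.memLp f)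
    exact h2.locallyIntegrable (by norm_num)
  have hder := LocallyIntegrable.ae_hasDerivAt_integral hG
  have hfin : ∀ᵐ t ∂(volume.restrict (Ioi (0 : ℝ))), f t = 0 := by
    rw [ae_restrict_iff' measurableSet_Ioi]
    filter_upwards [hder] with t ht hpos
    have h3 := ht 0
    have h4 : HasDerivAt (fun x => ∫ s in (0 : ℝ)..x, (Ioi (0 : ℝ)).indicator (fun t => f t) s)
        0 t := by
      refine (hasDerivAt_const t (0 : ℂ)).congr_of_eventuallyEq ?_
      filter_upwards [Ioi_mem_nhds hpos] with x hx
      have hx' : (0 : ℝ) ≤ x := le_of_lt hx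
      rw [← hint x hx']
      refine integral_congr_halfLine ?_ x hx'
      filter_upwards [ae_restrict_mem measurableSet_Ioi] with s hs
      simp only [indicator_of_mem hs]
    have h5 := h3.unique h4
    rwa [indicator_of_mem hpos] at h5
  exact (Lp.eq_zero_iff_ae_eq_zero).2 hfin

/-- The (unbounded) operator `L_V = -d²/dx² + V` on `L²(0, ∞)` with Dirichlet condition at zero. -/
def schrodingerOperator (V : ℝ → ℂ) : HalfLineL2 →ₗ.[ℂ] HalfLineL2 :=
  (dirichletGraph V).toLinearPMap

theorem schrodingerOperator_graph (V : ℝ → ℂ) :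
    (schrodingerOperator V).graph = dirichletGraph V :=
  Submodule.toLinearPMap_graph_eq _ (dirichletGraph_functional V)

/-- `ker (T - μ)^n` for an unbounded operator `T`. -/
def powKer {H : Type*} [AddCommGroup H] [Module ℂ H] (T : H →ₗ.[ℂ] H) (μ : ℂ) :
    ℕ → Submodule ℂ H
  | 0 => ⊥
  | n + 1 => ((powKer T μ n).comap (T.toFun - μ • T.domain.subtype)).map T.domain.subtype

/-- The root subspace `⋃ₙ ker (T - μ)^n`. -/
def rootSpace {H : Type*} [AddCommGroup H] [Module ℂ H] (T : H →ₗ.[ℂ] H) (μ : ℂ) :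
    Submodule ℂ H :=
  ⨆ n : ℕ, powKer T μ n

/-- The algebraic multiplicity of `μ` as an eigenvalue of `T`: the dimension of the root subspace
(`0` exactly when `μ` is not an eigenvalue, `⊤` for an infinite-dimensional root subspace). -/
def algMultiplicity {H : Type*} [AddCommGroup H] [Module ℂ H] (T : H →ₗ.[ℂ] H) (μ : ℂ) : ℕ∞ :=
  Cardinal.toENat (Module.rank ℂ (rootSpace T μ))

/-- `(e^{2ikt} - 1) / (2ik)`, with its limit value `t` at `k = 0`. -/
def jostKernel (k : ℂ) (t : ℝ) : ℂ :=
  if k = 0 then (t : ℂ) else (Complex.exp (2 * Complex.I * k * t) - 1) / (2 * Complex.I * k)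

/-- The successive approximations `ε⁽ⁿ⁾(x, k)`. -/
def jostIterate (V : ℝ → ℂ) (k : ℂ) : ℕ → ℝ → ℂ
  | 0 => fun _ => 1
  | n + 1 => fun x => ∫ ξ in Ioi x, jostKernel k (ξ - x) * V ξ * jostIterate V k n ξ

/-- The Jost solution `e(x, k) = e^{ikx} ∑ₙ ε⁽ⁿ⁾(x, k)` of `-y'' + V y = k² y`, which is asymptotic
to `e^{ikx}` as `x → ∞`; if `∫ e^{ax} |V| < ∞`, this is meaningful for `Im k > -a/2`. -/
def jostSolution (V : ℝ → ℂ) (x : ℝ) (k : ℂ) : ℂ :=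
  Complex.exp (Complex.I * k * x) * ∑' n : ℕ, jostIterate V k n x

/-- The Jost function `e(k) = e(0, k)`. -/
def jostFunction (V : ℝ → ℂ) (k : ℂ) : ℂ := jostSolution V 0 k

/-- `N(V)`: the total number of eigenvalues of `L_V`, counted with algebraic multiplicity, and of
spectral singularities `k²`, which are given by the real zeros `k` of the Jost function, counted
with the order of the zero. -/
def totalMultiplicity (V : ℝ → ℂ) : ℝ≥0∞ :=
  (∑' μ : ℂ, (algMultiplicity (schrodingerOperator V) μ : ℝ≥0∞)) +
    ∑' k : ℝ, (analyticOrderAt (jostFunction V) (k : ℂ) : ℝ≥0∞)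

end HalfLineSchrodinger

end

/-!
The kernel `(e^{2ikt} - 1) / (2ik)` is bounded by `e^{τt} / |k|` for every `τ ≥ max(0, -2 Im k)`, so
the successive approximations are dominated by an exponential series. Hence the Jost function is
analytic in `Im k > -b/2`, satisfies `|e(k)| ≤ exp (|k|⁻¹ ∫ e^{bx} |V|)` on `Im k ≥ -b/2`, and
satisfies `|e(k) - 1| ≤ exp (|k|⁻¹ ∫ |V|) - 1` on `Im k ≥ 0`, so that its zeros there lie in
`|k| ≤ b`.

For `(L_V - μ) u = f` Green's identity reads `(k² - μ) ⟨u, e(·, k)⟩ = ⟨f, e(·, k)⟩ - u'(0) e(k)`.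
Applied along a chain of root vectors of length `n` at `μ = κ²`, it shows that `(k² - μ)ⁿ` times a
bounded function is `e(k) p(k²)` with `p(μ) ≠ 0`, so `e` has a zero of order at least `n` at `κ`.
As the eigenspaces are lines, the algebraic multiplicity of `μ` is at most the order of the zero.

It remains to count the zeros of `e` in the half-disc `|k| ≤ b`, `Im k ≥ 0`. It is contained in the
disc of radius `√5 b` about `2ib`, and Jensen's formula applies to the concentric disc of radius
`2.495 b`, which stays in `Im k > -b/2` and away from `k = 0` on its boundary.
-/

namespace HalfLineSchrodinger

open Filter Topology

/-! ### Indefinite integrals and linear equations on the half-line -/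

/-- `F` is, on `[0, ∞)`, an indefinite integral of the locally integrable function `f`: this encodes
that `F` is locally absolutely continuous with `F' = f` almost everywhere. -/
structure IsPrimitive {E : Type*} [NormedAddCommGroup E] [NormedSpace ℝ E] (F f : ℝ → E) :
    Prop where
  intervalIntegrable_zero : ∀ x, 0 ≤ x → IntervalIntegrable f volume 0 x
  eq_add_integral : ∀ x, 0 ≤ x → F x = F 0 + ∫ t in (0 : ℝ)..x, f t

section Primitive

variable {E : Type*} [NormedAddCommGroup E] [NormedSpace ℝ E] {F G f g : ℝ → E}

theorem isPrimitive_integral (hf : ∀ x, 0 ≤ x → IntervalIntegrable f volume 0 x) :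
    IsPrimitive (fun x => ∫ t in (0 : ℝ)..x, f t) f :=
  ⟨hf, fun x _ => by simp⟩

theorem isPrimitive_integral_Ioi (hf : IntegrableOn f (Ioi 0)) :
    IsPrimitive (fun x => ∫ t in Ioi x, f t) (fun x => -f x) where
  intervalIntegrable_zero x hx :=
    ((intervalIntegrable_iff_integrableOn_Ioc_of_le hx).2
      (hf.mono_set Ioc_subset_Ioi_self)).neg
  eq_add_integral x hx := by
    rw [intervalIntegral.integral_neg, ← intervalIntegral.integral_Ioi_sub_Ioi hf hx]
    abel

theorem isPrimitive_of_hasDerivWithinAt [CompleteSpace E]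
    (hF : ∀ x, 0 ≤ x → HasDerivWithinAt F (f x) (Ici 0) x) (hf : ContinuousOn f (Ici 0)) :
    IsPrimitive F f := by
  have hfi : ∀ x, 0 ≤ x → IntervalIntegrable f volume 0 x := fun x hx =>
    (hf.mono (by rw [uIcc_of_le hx]; exact Icc_subset_Ici_self)).intervalIntegrable
  refine ⟨hfi, fun x hx => ?_⟩
  rw [intervalIntegral.integral_eq_sub_of_hasDeriv_right_of_le hx
    (fun t ht => (hF t ht.1).continuousWithinAt.mono Icc_subset_Ici_self)
    (fun t ht => (hF t ht.1.le).mono (Ioi_subset_Ici ht.1.le)) (hfi x hx)]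
  abel

namespace IsPrimitive

theorem intervalIntegrable (hF : IsPrimitive F f) {x y : ℝ} (hx : 0 ≤ x) (hy : 0 ≤ y) :
    IntervalIntegrable f volume x y :=
  (hF.intervalIntegrable_zero x hx).symm.trans (hF.intervalIntegrable_zero y hy)

theorem integral_eq_sub (hF : IsPrimitive F f) {x y : ℝ} (hx : 0 ≤ x) (hy : 0 ≤ y) :
    ∫ t in x..y, f t = F y - F x := by
  rw [hF.eq_add_integral x hx, hF.eq_add_integral y hy,
    ← intervalIntegral.integral_interval_sub_left (hF.intervalIntegrable_zero y hy)
      (hF.intervalIntegrable_zero x hx)]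
  abel

theorem integral_Ioi_eq_sub (hF : IsPrimitive F f) {x : ℝ} (hx : 0 ≤ x)
    (hf : IntegrableOn f (Ioi x)) {l : E} (hl : Tendsto F atTop (𝓝 l)) :
    ∫ t in Ioi x, f t = l - F x := by
  refine tendsto_nhds_unique (intervalIntegral_tendsto_integral_Ioi x hf tendsto_id)
    ((hl.sub_const (F x)).congr' ?_)
  filter_upwards [eventually_ge_atTop x] with y hy
  exact (hF.integral_eq_sub hx (hx.trans hy)).symm

theorem congr_ae (hF : IsPrimitive F f) (h : f =ᵐ[volume.restrict (Ioi 0)] g) :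
    IsPrimitive F g where
  intervalIntegrable_zero x hx := by
    refine (hF.intervalIntegrable_zero x hx).congr_ae ?_
    rw [uIoc_of_le hx]
    exact ae_mono (Measure.restrict_mono Ioc_subset_Ioi_self le_rfl) h
  eq_add_integral x hx := by
    rw [hF.eq_add_integral x hx]
    congr 1
    refine intervalIntegral.integral_congr_ae_restrict ?_
    rw [uIoc_of_le hx]
    exact ae_mono (Measure.restrict_mono Ioc_subset_Ioi_self le_rfl) h

theorem congr_left (hF : IsPrimitive F f) (h : ∀ x, 0 ≤ x → F x = G x) : IsPrimitive G f :=
  ⟨hF.intervalIntegrable_zero, fun x hx => by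
    rw [← h x hx, ← h 0 le_rfl, hF.eq_add_integral x hx]⟩

theorem sub (hF : IsPrimitive F f) (hG : IsPrimitive G g) :
    IsPrimitive (fun x => F x - G x) (fun x => f x - g x) where
  intervalIntegrable_zero x hx :=
    (hF.intervalIntegrable_zero x hx).sub (hG.intervalIntegrable_zero x hx)
  eq_add_integral x hx := by
    rw [intervalIntegral.integral_sub (hF.intervalIntegrable_zero x hx)
      (hG.intervalIntegrable_zero x hx), hF.eq_add_integral x hx, hG.eq_add_integral x hx]
    abel

theorem absolutelyContinuousOnInterval (hF : IsPrimitive F f) {x : ℝ} (hx : 0 ≤ x) :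
    AbsolutelyContinuousOnInterval F 0 x := by
  have hnorm : IntervalIntegrable (fun t => ‖f t‖) volume 0 x :=
    (hF.intervalIntegrable_zero x hx).norm
  refine squeeze_zero' (.of_forall fun _ => Finset.sum_nonneg fun _ _ => dist_nonneg) ?_
    (hnorm.absolutelyContinuousOnInterval_intervalIntegral left_mem_uIcc)
  rw [eventually_inf_principal]
  filter_upwards with I hI
  refine Finset.sum_le_sum fun i hi => ?_
  have hmem := hI.1 i hi
  rw [uIcc_of_le hx] at hmem
  have hsub : ∀ t ∈ Icc 0 x, IntervalIntegrable (fun t => ‖f t‖) volume 0 t := fun t ht =>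
    (hF.intervalIntegrable_zero t ht.1).norm
  rw [dist_comm, dist_comm (∫ t in (0 : ℝ)..(I.2 i).1, ‖f t‖), dist_eq_norm, Real.dist_eq,
    ← hF.integral_eq_sub hmem.1.1 hmem.2.1,
    intervalIntegral.integral_interval_sub_left (hsub _ hmem.2) (hsub _ hmem.1)]
  exact intervalIntegral.norm_integral_le_abs_integral_norm

theorem continuousOn (hF : IsPrimitive F f) : ContinuousOn F (Ici 0) := by
  intro x (hx : 0 ≤ x)
  have hcont := (hF.absolutelyContinuousOnInterval (by linarith : 0 ≤ x + 1)).continuousOn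
  rw [uIcc_of_le (by linarith)] at hcont
  refine (hcont x ⟨hx, by linarith⟩).mono_of_mem_nhdsWithin ?_
  rw [← Ici_inter_Iic]
  exact inter_mem_nhdsWithin _ (Iic_mem_nhds (by linarith))

theorem ae_hasDerivAt [CompleteSpace E] (hF : IsPrimitive F f) {x : ℝ} (hx : 0 ≤ x) :
    ∀ᵐ t, t ∈ Ioo 0 x → HasDerivAt F (f t) t := by
  filter_upwards [(hF.intervalIntegrable_zero x hx).ae_hasDerivAt_integral] with t ht htx
  refine ((ht (Icc_subset_uIcc (Ioo_subset_Icc_self htx)) 0 left_mem_uIcc).const_add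
    (F 0)).congr_of_eventuallyEq ?_
  filter_upwards [Ioi_mem_nhds htx.1] with s hs
  exact hF.eq_add_integral s (le_of_lt hs)

end IsPrimitive

theorem isPrimitive_of_ae_hasDerivAt [CompleteSpace E]
    (hF : ∀ x, 0 ≤ x → AbsolutelyContinuousOnInterval F 0 x)
    (hf : ∀ x, 0 ≤ x → IntervalIntegrable f volume 0 x)
    (hderiv : ∀ x, 0 ≤ x → ∀ᵐ t, t ∈ Ioo 0 x → HasDerivAt F (f t) t) : IsPrimitive F f := by
  refine ⟨hf, fun x hx => ?_⟩
  have hprim := isPrimitive_integral hf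
  have hae : ∀ᵐ t, t ∈ uIcc 0 x → HasDerivAt (F - fun x => ∫ t in (0 : ℝ)..x, f t) 0 t := by
    filter_upwards [hderiv x hx, hprim.ae_hasDerivAt hx, Measure.ae_ne volume 0,
      Measure.ae_ne volume x] with t hFt hit ht0 htx ht
    rw [uIcc_of_le hx] at ht
    have htIoo : t ∈ Ioo 0 x := ⟨ht.1.lt_of_ne' ht0, ht.2.lt_of_ne htx⟩
    simpa using (hFt htIoo).sub (hit htIoo)
  obtain ⟨C, hC⟩ := ((hF x hx).sub
    (hprim.absolutelyContinuousOnInterval hx)).const_of_ae_hasDerivAt_zero hae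
  have hends := (hC x right_mem_uIcc).trans (hC 0 left_mem_uIcc).symm
  simpa [sub_eq_iff_eq_add] using hends

end Primitive

section PrimitiveMul

variable {𝕜 : Type*} [RCLike 𝕜] {F G f g : ℝ → 𝕜}

theorem IsPrimitive.const_mul (hF : IsPrimitive F f) (c : 𝕜) :
    IsPrimitive (fun x => c * F x) (fun x => c * f x) where
  intervalIntegrable_zero x hx := (hF.intervalIntegrable_zero x hx).const_mul c
  eq_add_integral x hx := by
    rw [intervalIntegral.integral_const_mul, hF.eq_add_integral x hx, mul_add]

theorem IsPrimitive.mul (hF : IsPrimitive F f) (hG : IsPrimitive G g) :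
    IsPrimitive (fun x => F x * G x) (fun x => f x * G x + F x * g x) := by
  refine isPrimitive_of_ae_hasDerivAt (fun x hx => (hF.absolutelyContinuousOnInterval hx).fun_smul
    (hG.absolutelyContinuousOnInterval hx)) (fun x hx => ?_) (fun x hx => ?_)
  · have hsub : uIcc 0 x ⊆ Ici 0 := by rw [uIcc_of_le hx]; exact Icc_subset_Ici_self
    exact ((hF.intervalIntegrable_zero x hx).mul_continuousOn (hG.continuousOn.mono hsub)).add
      ((hG.intervalIntegrable_zero x hx).continuousOn_mul (hF.continuousOn.mono hsub))
  · filter_upwards [hF.ae_hasDerivAt hx, hG.ae_hasDerivAt hx] with t hFt hGt ht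
    exact (hFt ht).mul (hGt ht)

theorem IsPrimitive.pow (hF : IsPrimitive F f) (n : ℕ) :
    IsPrimitive (fun x => F x ^ (n + 1)) (fun x => (n + 1) * (f x * F x ^ n)) := by
  induction n with
  | zero => simpa using hF
  | succ n ih =>
    convert ih.mul hF using 1
    · simp only [pow_succ]
    · ext x
      push_cast
      ring

end PrimitiveMul

theorem isPrimitive_exp (c : ℂ) :
    IsPrimitive (fun x : ℝ => Complex.exp (c * x)) (fun x : ℝ => c * Complex.exp (c * x)) := by
  refine isPrimitive_of_hasDerivWithinAt (fun x _ => HasDerivAt.hasDerivWithinAt ?_)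
    (Continuous.continuousOn (by fun_prop))
  simpa [mul_comm] using ((Complex.ofRealCLM.hasDerivAt (x := x)).const_mul c).cexp

theorem integrableOn_mul_integral_Ioi_pow {g : ℝ → ℝ} (hg : IntegrableOn g (Ioi 0)) (n : ℕ) :
    IntegrableOn (fun t => g t * (∫ s in Ioi t, g s) ^ n) (Ioi 0) := by
  refine Integrable.mul_bdd (c := (∫ s in Ioi (0 : ℝ), ‖g s‖) ^ n) hg
    (((isPrimitive_integral_Ioi hg).continuousOn.mono Ioi_subset_Ici_self).pow n
      |>.aestronglyMeasurable measurableSet_Ioi)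
    (ae_restrict_of_forall_mem measurableSet_Ioi fun t ht => ?_)
  rw [norm_pow]
  gcongr
  exact (norm_integral_le_integral_norm _).trans <|
    setIntegral_mono_set hg.norm (ae_of_all _ fun _ => norm_nonneg _)
      (Ioi_subset_Ioi (le_of_lt ht)).eventuallyLE

theorem integral_Ioi_mul_integral_Ioi_pow {g : ℝ → ℝ} (hg : IntegrableOn g (Ioi 0)) (n : ℕ)
    {x : ℝ} (hx : 0 ≤ x) :
    ∫ t in Ioi x, g t * (∫ s in Ioi t, g s) ^ n = (∫ s in Ioi x, g s) ^ (n + 1) / (n + 1) := by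
  have hprim := ((isPrimitive_integral_Ioi hg).pow n).const_mul (-((n : ℝ) + 1)⁻¹)
  have hcancel : (fun t => -((n : ℝ) + 1)⁻¹ * ((n + 1) * (-g t * (∫ s in Ioi t, g s) ^ n))) =
      fun t => g t * (∫ s in Ioi t, g s) ^ n := by
    ext t
    field_simp
  rw [hcancel] at hprim
  have htail : Tendsto (fun t => -((n : ℝ) + 1)⁻¹ * (∫ s in Ioi t, g s) ^ (n + 1)) atTop (𝓝 0) := by
    simpa using ((tendsto_integral_Ioi_zero tendsto_id).pow (n + 1)).const_mul (-((n : ℝ) + 1)⁻¹)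
  rw [hprim.integral_Ioi_eq_sub hx
    ((integrableOn_mul_integral_Ioi_pow hg n).mono_set (Ioi_subset_Ioi hx)) htail]
  field_simp
  ring

theorem eq_zero_of_le_integral_mul {φ w G : ℝ → ℝ} {X : ℝ} (hG : IsPrimitive G w) (hG0 : G 0 = 0)
    (hw : ∀ t, 0 ≤ w t) (hφ0 : ∀ x ∈ Icc 0 X, 0 ≤ φ x) (hφ : ContinuousOn φ (Icc 0 X))
    (hle : ∀ x ∈ Icc 0 X, φ x ≤ ∫ t in (0 : ℝ)..x, w t * φ t) : ∀ x ∈ Icc 0 X, φ x = 0 := by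
  obtain ⟨C, hC⟩ := isCompact_Icc.exists_bound_of_continuousOn hφ
  have hpow : ∀ n : ℕ, ∀ x ∈ Icc 0 X, φ x ≤ C * (G x ^ n / n.factorial) := by
    intro n
    induction n with
    | zero => intro x hx; simpa using (le_abs_self _).trans (hC x hx)
    | succ n ih =>
      intro x hx
      have hprim := (hG.pow n).const_mul (C / n.factorial / (n + 1))
      have hφi : IntervalIntegrable (fun t => w t * φ t) volume 0 x := by
        refine (hG.intervalIntegrable_zero x hx.1).mul_continuousOn (hφ.mono ?_)
        rw [uIcc_of_le hx.1]
        exact Icc_subset_Icc_right hx.2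
      calc φ x ≤ ∫ t in (0 : ℝ)..x, w t * φ t := hle x hx
        _ ≤ ∫ t in (0 : ℝ)..x, C / n.factorial / (n + 1) * ((n + 1) * (w t * G t ^ n)) := by
          refine intervalIntegral.integral_mono_on hx.1 hφi
            (hprim.intervalIntegrable_zero x hx.1) fun t ht => ?_
          refine (mul_le_mul_of_nonneg_left (ih t ⟨ht.1, ht.2.trans hx.2⟩) (hw t)).trans_eq ?_
          field_simp
        _ = C * (G x ^ (n + 1) / (n + 1).factorial) := by
          rw [hprim.integral_eq_sub le_rfl hx.1, hG0, Nat.factorial_succ]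
          push_cast
          field_simp
          ring
  intro x hx
  have hlim : Tendsto (fun n : ℕ => C * (G x ^ n / n.factorial)) atTop (𝓝 0) := by
    simpa using (FloorSemiring.tendsto_pow_div_factorial_atTop (G x)).const_mul C
  exact le_antisymm (ge_of_tendsto' hlim fun n => hpow n x hx) (hφ0 x hx)

/-- `y` solves the equation `-y'' + q y = 0` on `[0, ∞)`, with `z` in the role of `y'`; for
`q = V - μ` this is the eigenvalue equation. -/
structure IsSolution (q y z : ℝ → ℂ) : Prop where
  isPrimitive : IsPrimitive y z
  isPrimitive_deriv : IsPrimitive z (fun t => q t * y t)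

namespace IsSolution

variable {q y z y₁ z₁ y₂ z₂ : ℝ → ℂ}

theorem const_mul (h : IsSolution q y z) (c : ℂ) :
    IsSolution q (fun x => c * y x) (fun x => c * z x) :=
  ⟨h.isPrimitive.const_mul c, by
    simpa only [mul_left_comm] using h.isPrimitive_deriv.const_mul c⟩

theorem sub (h₁ : IsSolution q y₁ z₁) (h₂ : IsSolution q y₂ z₂) :
    IsSolution q (fun x => y₁ x - y₂ x) (fun x => z₁ x - z₂ x) :=
  ⟨h₁.isPrimitive.sub h₂.isPrimitive, by
    simpa only [mul_sub] using h₁.isPrimitive_deriv.sub h₂.isPrimitive_deriv⟩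

theorem norm_add_norm_le_integral (h : IsSolution q y z)
    (hq : ∀ x, 0 ≤ x → IntervalIntegrable q volume 0 x) (hy0 : y 0 = 0) (hz0 : z 0 = 0)
    {x : ℝ} (hx : 0 ≤ x) :
    ‖y x‖ + ‖z x‖ ≤ ∫ t in (0 : ℝ)..x, (1 + ‖q t‖) * (‖y t‖ + ‖z t‖) := by
  obtain ⟨hy, hz⟩ := h
  have hzi := (hy.intervalIntegrable_zero x hx).norm
  have hqyi := (hz.intervalIntegrable_zero x hx).norm
  have hcont : ContinuousOn (fun x => ‖y x‖ + ‖z x‖) (uIcc 0 x) := by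
    rw [uIcc_of_le hx]
    exact (hy.continuousOn.norm.add hz.continuousOn.norm).mono Icc_subset_Ici_self
  calc ‖y x‖ + ‖z x‖ ≤ (∫ s in (0 : ℝ)..x, ‖z s‖) + ∫ s in (0 : ℝ)..x, ‖q s * y s‖ := by
        rw [hy.eq_add_integral x hx, hz.eq_add_integral x hx, hy0, hz0, zero_add, zero_add]
        gcongr <;> exact intervalIntegral.norm_integral_le_integral_norm hx
    _ = ∫ s in (0 : ℝ)..x, (‖z s‖ + ‖q s * y s‖) :=
        (intervalIntegral.integral_add hzi hqyi).symm
    _ ≤ _ := by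
        refine intervalIntegral.integral_mono_on hx (hzi.add hqyi)
          ((intervalIntegrable_const.add (hq x hx).norm).mul_continuousOn hcont) fun s _ => ?_
        rw [norm_mul]
        nlinarith [norm_nonneg (y s), mul_nonneg (norm_nonneg (q s)) (norm_nonneg (z s))]

theorem eq_zero (h : IsSolution q y z) (hq : ∀ x, 0 ≤ x → IntervalIntegrable q volume 0 x)
    (hy0 : y 0 = 0) (hz0 : z 0 = 0) {x : ℝ} (hx : 0 ≤ x) : y x = 0 := by
  have hzero := eq_zero_of_le_integral_mul (X := x) (φ := fun x => ‖y x‖ + ‖z x‖)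
    (isPrimitive_integral fun x hx => intervalIntegrable_const.add (hq x hx).norm)
    intervalIntegral.integral_same (fun t => by positivity) (fun _ _ => by positivity)
    ((h.isPrimitive.continuousOn.norm.add h.isPrimitive_deriv.continuousOn.norm).mono
      Icc_subset_Ici_self)
    (fun t ht => h.norm_add_norm_le_integral hq hy0 hz0 ht.1) x ⟨hx, le_rfl⟩
  exact norm_eq_zero.1 ((add_eq_zero_iff_of_nonneg (norm_nonneg _) (norm_nonneg _)).1 hzero).1

theorem mul_eq_mul (h₁ : IsSolution q y₁ z₁) (h₂ : IsSolution q y₂ z₂)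
    (hq : ∀ x, 0 ≤ x → IntervalIntegrable q volume 0 x) (hy₁ : y₁ 0 = 0) (hy₂ : y₂ 0 = 0)
    {x : ℝ} (hx : 0 ≤ x) : z₂ 0 * y₁ x = z₁ 0 * y₂ x :=
  sub_eq_zero.1 <| ((h₁.const_mul (z₂ 0)).sub (h₂.const_mul (z₁ 0))).eq_zero hq
    (by simp [hy₁, hy₂]) (by ring) hx

end IsSolution

/-! ### Convergence of the successive approximations -/

theorem le_inv_mul_exp {δ : ℝ} (hδ : 0 < δ) (t : ℝ) : t ≤ δ⁻¹ * Real.exp (δ * t) := by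
  rw [inv_mul_eq_div, le_div_iff₀ hδ]
  linarith [Real.add_one_le_exp (δ * t)]

theorem norm_exp_I_mul (k : ℂ) (x : ℝ) :
    ‖Complex.exp (Complex.I * k * x)‖ = Real.exp (-(k.im * x)) := by
  rw [Complex.norm_exp]
  congr 1
  simp

theorem norm_exp_two_I_mul (k : ℂ) (t : ℝ) :
    ‖Complex.exp (2 * Complex.I * k * t)‖ = Real.exp (-(2 * k.im) * t) := by
  rw [Complex.norm_exp]
  congr 1
  simp

theorem norm_exp_two_I_mul_le_one {k : ℂ} (hk : 0 ≤ k.im) {t : ℝ} (ht : 0 ≤ t) :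
    ‖Complex.exp (2 * Complex.I * k * t)‖ ≤ 1 := by
  rw [norm_exp_two_I_mul, Real.exp_le_one_iff]
  nlinarith

theorem jostKernel_eq_integral (k : ℂ) (t : ℝ) :
    jostKernel k t = ∫ s in (0 : ℝ)..t, Complex.exp (2 * Complex.I * k * s) := by
  rw [jostKernel]
  split_ifs with hk
  · simp [hk]
  · rw [integral_exp_mul_complex (by simp [hk])]
    simp

theorem jostKernel_zero_right (k : ℂ) : jostKernel k 0 = 0 := by
  simp [jostKernel_eq_integral]

theorem continuous_jostKernel (k : ℂ) : Continuous (jostKernel k) := by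
  rw [funext (jostKernel_eq_integral k)]
  exact intervalIntegral.continuous_primitive
    (fun _ _ => Continuous.intervalIntegrable (by fun_prop) _ _) 0

theorem norm_jostKernel_le_inv_norm_mul_exp {k : ℂ} (hk : k ≠ 0) {τ t : ℝ} (hτ : 0 ≤ τ)
    (hτk : -(2 * k.im) ≤ τ) (ht : 0 ≤ t) : ‖jostKernel k t‖ ≤ ‖k‖⁻¹ * Real.exp (τ * t) := by
  have hnum : ‖Complex.exp (2 * Complex.I * k * t) - 1‖ ≤ 2 * Real.exp (τ * t) := by
    refine (norm_sub_le _ _).trans ?_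
    rw [norm_exp_two_I_mul, norm_one, two_mul (Real.exp _)]
    exact add_le_add (Real.exp_le_exp.2 (mul_le_mul_of_nonneg_right hτk ht))
      (Real.one_le_exp (mul_nonneg hτ ht))
  have hden : ‖2 * Complex.I * k‖ = 2 * ‖k‖ := by simp
  rw [jostKernel, if_neg hk, norm_div, hden]
  calc _ ≤ 2 * Real.exp (τ * t) / (2 * ‖k‖) := by gcongr
    _ = _ := by field_simp

theorem norm_jostKernel_le_inv_mul_exp {k : ℂ} {a δ t : ℝ} (hδ : 0 < δ) (hδa : δ ≤ a)
    (hk : -(2 * k.im) ≤ a - δ) (ht : 0 ≤ t) : ‖jostKernel k t‖ ≤ δ⁻¹ * Real.exp (a * t) := by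
  have hlin : ‖jostKernel k t‖ ≤ Real.exp ((a - δ) * t) * |t - 0| := by
    rw [jostKernel_eq_integral]
    refine intervalIntegral.norm_integral_le_of_norm_le_const fun s hs => ?_
    rw [uIoc_of_le ht] at hs
    rw [norm_exp_two_I_mul]
    exact Real.exp_le_exp.2 ((mul_le_mul_of_nonneg_right hk hs.1.le).trans
      (mul_le_mul_of_nonneg_left hs.2 (by linarith)))
  rw [sub_zero, abs_of_nonneg ht] at hlin
  calc ‖jostKernel k t‖ ≤ Real.exp ((a - δ) * t) * t := hlin
    _ ≤ Real.exp ((a - δ) * t) * (δ⁻¹ * Real.exp (δ * t)) := by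
        gcongr
        exact le_inv_mul_exp hδ t
    _ = δ⁻¹ * (Real.exp ((a - δ) * t) * Real.exp (δ * t)) := by ring
    _ = δ⁻¹ * Real.exp (a * t) := by rw [← Real.exp_add]; ring_nf

theorem jostKernel_eq_dslope (k : ℂ) (t : ℝ) :
    jostKernel k t =
      (2 * Complex.I)⁻¹ * dslope (fun k : ℂ => Complex.exp (2 * Complex.I * k * t)) 0 k := by
  by_cases hk : k = 0
  · have hderiv : HasDerivAt (fun k : ℂ => Complex.exp (2 * Complex.I * k * t))
        (Complex.exp (2 * Complex.I * 0 * t) * (2 * Complex.I * 1 * t)) 0 :=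
      (((hasDerivAt_id (0 : ℂ)).const_mul (2 * Complex.I)).mul_const (t : ℂ)).cexp
    rw [hk, dslope_same, hderiv.deriv, jostKernel, if_pos rfl]
    field_simp
    simp
  · rw [dslope_of_ne _ hk, slope_def_field, jostKernel, if_neg hk]
    simp only [mul_zero, zero_mul, Complex.exp_zero, sub_zero]
    field_simp

theorem differentiable_jostKernel (t : ℝ) : Differentiable ℂ fun k => jostKernel k t := by
  have hdslope :
      Differentiable ℂ (dslope (fun k : ℂ => Complex.exp (2 * Complex.I * k * t)) 0) := by
    rw [← differentiableOn_univ, Complex.differentiableOn_dslope univ_mem]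
    exact Differentiable.differentiableOn (by fun_prop)
  simpa only [jostKernel_eq_dslope] using hdslope.const_mul _

/-- Integrability of `e^{τ x} V(x)` over the half-line. -/
def ExpIntegrable (V : ℝ → ℂ) (τ : ℝ) : Prop :=
  IntegrableOn (fun x : ℝ => (Real.exp (τ * x) : ℂ) * V x) (Ioi 0)

namespace ExpIntegrable

variable {V : ℝ → ℂ} {σ τ : ℝ}

theorem integrableOn_exp_mul_norm (hV : ExpIntegrable V τ) :
    IntegrableOn (fun t => Real.exp (τ * t) * ‖V t‖) (Ioi 0) := by
  refine hV.norm.congr (ae_of_all _ fun t => ?_)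
  beta_reduce
  rw [norm_mul, Complex.norm_real, Real.norm_of_nonneg (Real.exp_pos _).le]

theorem aestronglyMeasurable (hV : ExpIntegrable V τ) :
    AEStronglyMeasurable V (volume.restrict (Ioi 0)) := by
  have hexp : Continuous fun x : ℝ => (Real.exp (-(τ * x)) : ℂ) := by fun_prop
  refine (hexp.aestronglyMeasurable.mul hV.1).congr (ae_of_all _ fun t => ?_)
  rw [Pi.mul_apply, ← mul_assoc, ← Complex.ofReal_mul, ← Real.exp_add]
  simp

theorem mono (hV : ExpIntegrable V τ) (hστ : σ ≤ τ) : ExpIntegrable V σ := by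
  have hexp : Continuous fun x : ℝ => (Real.exp (σ * x) : ℂ) := by fun_prop
  refine Integrable.mono' hV.integrableOn_exp_mul_norm
    (hexp.aestronglyMeasurable.mul hV.aestronglyMeasurable)
    (ae_restrict_of_forall_mem measurableSet_Ioi fun t (ht : 0 < t) => ?_)
  rw [norm_mul, Complex.norm_real, Real.norm_of_nonneg (Real.exp_pos _).le]
  gcongr

theorem integrableOn (hV : ExpIntegrable V τ) (hτ : 0 ≤ τ) : IntegrableOn V (Ioi 0) := by
  simpa [ExpIntegrable] using hV.mono hτ

theorem intervalIntegrable (hV : ExpIntegrable V τ) (hτ : 0 ≤ τ) {x : ℝ} (hx : 0 ≤ x) :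
    IntervalIntegrable V volume 0 x :=
  (intervalIntegrable_iff_integrableOn_Ioc_of_le hx).2
    ((hV.integrableOn hτ).mono_set Ioc_subset_Ioi_self)

end ExpIntegrable

/-- The tail `∫_x^∞ e^{τ t} |V t| dt`. -/
noncomputable def expTail (V : ℝ → ℂ) (τ x : ℝ) : ℝ :=
  ∫ t in Ioi x, Real.exp (τ * t) * ‖V t‖

theorem expTail_nonneg (V : ℝ → ℂ) (τ x : ℝ) : 0 ≤ expTail V τ x :=
  integral_nonneg fun _ => by positivity

theorem ExpIntegrable.expTail_anti {V : ℝ → ℂ} {τ : ℝ} (hV : ExpIntegrable V τ) {x y : ℝ}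
    (hx : 0 ≤ x) (hxy : x ≤ y) : expTail V τ y ≤ expTail V τ x :=
  setIntegral_mono_set (hV.integrableOn_exp_mul_norm.mono_set (Ioi_subset_Ioi hx))
    (ae_of_all _ fun _ => by positivity) (Ioi_subset_Ioi hxy).eventuallyLE

theorem hasSum_pow_expTail_div_factorial (V : ℝ → ℂ) (κ τ x : ℝ) :
    HasSum (fun n : ℕ => (κ * expTail V τ x) ^ n / n.factorial) (Real.exp (κ * expTail V τ x)) := by
  rw [Real.exp_eq_exp_ℝ]
  exact NormedSpace.expSeries_div_hasSum_exp _

/-- One step `m ↦ ∫_x^∞ (e^{2ik(ξ-x)} - 1) / (2ik) V(ξ) m(ξ) dξ` of the successive approximations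
defining the Jost solution. -/
noncomputable def jostTransform (V : ℝ → ℂ) (k : ℂ) (m : ℝ → ℂ) (x : ℝ) : ℂ :=
  ∫ ξ in Ioi x, jostKernel k (ξ - x) * V ξ * m ξ

theorem jostIterate_succ (V : ℝ → ℂ) (k : ℂ) (n : ℕ) :
    jostIterate V k (n + 1) = jostTransform V k (jostIterate V k n) := rfl

/-- The sum `e^{-ikx} e(x, k)` of the successive approximations. -/
noncomputable def jostAmplitude (V : ℝ → ℂ) (k : ℂ) (x : ℝ) : ℂ := ∑' n : ℕ, jostIterate V k n x

theorem jostSolution_eq (V : ℝ → ℂ) (k : ℂ) (x : ℝ) :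
    jostSolution V x k = Complex.exp (Complex.I * k * x) * jostAmplitude V k x := rfl

/-- The hypotheses under which the successive approximations converge: `jostKernel k` grows at most
like `κ e^{τ t}`, and `e^{τ t} V` is integrable. -/
structure KernelBound (V : ℝ → ℂ) (k : ℂ) (κ τ : ℝ) : Prop where
  rate_nonneg : 0 ≤ τ
  norm_le : ∀ t, 0 ≤ t → ‖jostKernel k t‖ ≤ κ * Real.exp (τ * t)
  expIntegrable : ExpIntegrable V τ

section Volterra

variable {V : ℝ → ℂ} {k : ℂ} {κ τ : ℝ} {m : ℝ → ℂ} {C : ℝ}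

/-- Extending the kernel by zero makes the domain of integration independent of `x`. -/
theorem jostTransform_eq_integral_Ioi_zero (m : ℝ → ℂ) {x : ℝ} (hx : 0 ≤ x) :
    jostTransform V k m x = ∫ ξ in Ioi 0, jostKernel k (max (ξ - x) 0) * V ξ * m ξ := by
  calc jostTransform V k m x
      = ∫ ξ in Ioi x, jostKernel k (max (ξ - x) 0) * V ξ * m ξ :=
        setIntegral_congr_fun measurableSet_Ioi fun ξ hξ => by
          simp only [max_eq_left (sub_nonneg.2 (mem_Ioi.1 hξ).le)]
    _ = _ := (setIntegral_eq_of_subset_of_forall_sdiff_eq_zero measurableSet_Ioi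
        (Ioi_subset_Ioi hx) fun ξ hξ => by
          rw [max_eq_right (sub_nonpos.2 (not_lt.1 hξ.2)), jostKernel_zero_right]
          ring).symm

theorem aestronglyMeasurable_jostKernel_mul
    (hV : AEStronglyMeasurable V (volume.restrict (Ioi 0))) (hm : ContinuousOn m (Ici 0)) (x : ℝ) :
    AEStronglyMeasurable (fun ξ => jostKernel k (max (ξ - x) 0) * V ξ * m ξ)
      (volume.restrict (Ioi 0)) := by
  have hkernel : Continuous fun ξ => jostKernel k (max (ξ - x) 0) :=
    (continuous_jostKernel k).comp (by fun_prop)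
  exact (hkernel.aestronglyMeasurable.mul hV).mul
    ((hm.mono Ioi_subset_Ici_self).aestronglyMeasurable measurableSet_Ioi)

namespace KernelBound

theorem const_nonneg (h : KernelBound V k κ τ) : 0 ≤ κ := by
  simpa [jostKernel_zero_right] using h.norm_le 0 le_rfl

theorem norm_jostKernel_mul_le (h : KernelBound V k κ τ) {x ξ : ℝ} (hx : 0 ≤ x) (hξ : 0 ≤ ξ)
    (hm : ‖m ξ‖ ≤ C) :
    ‖jostKernel k (max (ξ - x) 0) * V ξ * m ξ‖ ≤ κ * C * (Real.exp (τ * ξ) * ‖V ξ‖) := by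
  have hκ := h.const_nonneg
  have hmax : τ * max (ξ - x) 0 ≤ τ * ξ :=
    mul_le_mul_of_nonneg_left (max_le (by linarith) hξ) h.rate_nonneg
  have hkernel : ‖jostKernel k (max (ξ - x) 0)‖ ≤ κ * Real.exp (τ * ξ) :=
    (h.norm_le _ (le_max_right _ _)).trans (by gcongr)
  rw [norm_mul, norm_mul]
  calc _ ≤ κ * Real.exp (τ * ξ) * ‖V ξ‖ * C := by gcongr
    _ = _ := by ring

theorem integrableOn_jostKernel_mul (h : KernelBound V k κ τ) (hm : ContinuousOn m (Ici 0))
    (hC : ∀ x, 0 ≤ x → ‖m x‖ ≤ C) {x : ℝ} (hx : 0 ≤ x) :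
    IntegrableOn (fun ξ => jostKernel k (max (ξ - x) 0) * V ξ * m ξ) (Ioi 0) :=
  Integrable.mono' (h.expIntegrable.integrableOn_exp_mul_norm.const_mul (κ * C))
    (aestronglyMeasurable_jostKernel_mul h.expIntegrable.aestronglyMeasurable hm x)
    (ae_restrict_of_forall_mem measurableSet_Ioi fun ξ hξ =>
      h.norm_jostKernel_mul_le hx (le_of_lt hξ) (hC ξ (le_of_lt hξ)))

theorem integral_norm_jostKernel_mul_le (h : KernelBound V k κ τ)
    (hC : ∀ x, 0 ≤ x → ‖m x‖ ≤ C) {x : ℝ} (hx : 0 ≤ x) :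
    ∫ ξ in Ioi 0, ‖jostKernel k (max (ξ - x) 0) * V ξ * m ξ‖ ≤ κ * C * expTail V τ 0 := by
  rw [expTail, ← integral_const_mul]
  exact integral_mono_of_nonneg (ae_of_all _ fun _ => norm_nonneg _)
    (h.expIntegrable.integrableOn_exp_mul_norm.const_mul _)
    (ae_restrict_of_forall_mem measurableSet_Ioi fun ξ hξ =>
      h.norm_jostKernel_mul_le hx (le_of_lt hξ) (hC ξ (le_of_lt hξ)))

theorem continuousOn_jostTransform (h : KernelBound V k κ τ) (hm : ContinuousOn m (Ici 0))
    (hC : ∀ x, 0 ≤ x → ‖m x‖ ≤ C) : ContinuousOn (jostTransform V k m) (Ici 0) := by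
  refine ContinuousOn.congr ?_ fun x hx => jostTransform_eq_integral_Ioi_zero m hx
  refine continuousOn_of_dominated (bound := fun ξ => κ * C * (Real.exp (τ * ξ) * ‖V ξ‖))
    (fun x _ => aestronglyMeasurable_jostKernel_mul h.expIntegrable.aestronglyMeasurable hm x)
    (fun x hx => ae_restrict_of_forall_mem measurableSet_Ioi fun ξ hξ =>
      h.norm_jostKernel_mul_le hx (le_of_lt hξ) (hC ξ (le_of_lt hξ)))
    (h.expIntegrable.integrableOn_exp_mul_norm.const_mul _)
    (ae_of_all _ fun ξ => Continuous.continuousOn ?_)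
  have hkernel : Continuous fun x => jostKernel k (max (ξ - x) 0) :=
    (continuous_jostKernel k).comp (by fun_prop)
  exact (hkernel.mul_const _).mul_const _

theorem norm_jostTransform_le (h : KernelBound V k κ τ) {n : ℕ}
    (hC : ∀ x, 0 ≤ x → ‖m x‖ ≤ C * expTail V τ x ^ n) {x : ℝ} (hx : 0 ≤ x) :
    ‖jostTransform V k m x‖ ≤ κ * C * (expTail V τ x ^ (n + 1) / (n + 1)) := by
  have hexp := h.expIntegrable.integrableOn_exp_mul_norm
  have htail : expTail V τ x ^ (n + 1) / (n + 1) =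
      ∫ t in Ioi x, Real.exp (τ * t) * ‖V t‖ * expTail V τ t ^ n :=
    (integral_Ioi_mul_integral_Ioi_pow hexp n hx).symm
  rw [htail, ← integral_const_mul, jostTransform]
  refine norm_integral_le_of_norm_le
    (((integrableOn_mul_integral_Ioi_pow hexp n).mono_set (Ioi_subset_Ioi hx)).const_mul _)
    (ae_restrict_of_forall_mem measurableSet_Ioi fun ξ (hξ : x < ξ) => ?_)
  have hbound := h.norm_jostKernel_mul_le hx (hx.trans hξ.le) (hC ξ (hx.trans hξ.le))
  rw [max_eq_left (sub_nonneg.2 hξ.le)] at hbound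
  refine hbound.trans_eq ?_
  simp only [expTail]
  ring

theorem norm_jostIterate_le (h : KernelBound V k κ τ) (n : ℕ) :
    ∀ x, 0 ≤ x → ‖jostIterate V k n x‖ ≤ (κ * expTail V τ x) ^ n / n.factorial := by
  induction n with
  | zero => intro x _; simp [jostIterate]
  | succ n ih =>
    intro x hx
    rw [jostIterate_succ]
    refine (h.norm_jostTransform_le (C := κ ^ n / n.factorial) (n := n) (fun y hy => ?_)
      hx).trans_eq ?_
    · exact (ih y hy).trans_eq (by rw [mul_pow]; ring)
    · rw [Nat.factorial_succ, mul_pow]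
      push_cast
      field_simp
      ring

theorem norm_jostIterate_le_expTail_zero (h : KernelBound V k κ τ) (n : ℕ) (x : ℝ) (hx : 0 ≤ x) :
    ‖jostIterate V k n x‖ ≤ (κ * expTail V τ 0) ^ n / n.factorial := by
  have hκ := h.const_nonneg
  have htail := expTail_nonneg V τ x
  refine (h.norm_jostIterate_le n x hx).trans ?_
  gcongr
  exact h.expIntegrable.expTail_anti le_rfl hx

theorem continuousOn_jostIterate (h : KernelBound V k κ τ) (n : ℕ) :
    ContinuousOn (jostIterate V k n) (Ici 0) := by
  induction n with
  | zero => exact continuousOn_const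
  | succ n ih => exact h.continuousOn_jostTransform ih (h.norm_jostIterate_le_expTail_zero n)

theorem summable_jostIterate (h : KernelBound V k κ τ) {x : ℝ} (hx : 0 ≤ x) :
    Summable fun n : ℕ => jostIterate V k n x :=
  (hasSum_pow_expTail_div_factorial V κ τ x).summable.of_norm_bounded
    fun n => h.norm_jostIterate_le n x hx

theorem continuousOn_jostAmplitude (h : KernelBound V k κ τ) :
    ContinuousOn (jostAmplitude V k) (Ici 0) :=
  continuousOn_tsum h.continuousOn_jostIterate (hasSum_pow_expTail_div_factorial V κ τ 0).summable
    h.norm_jostIterate_le_expTail_zero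

theorem norm_jostAmplitude_le (h : KernelBound V k κ τ) {x : ℝ} (hx : 0 ≤ x) :
    ‖jostAmplitude V k x‖ ≤ Real.exp (κ * expTail V τ 0) :=
  tsum_of_norm_bounded (hasSum_pow_expTail_div_factorial V κ τ 0)
    fun n => h.norm_jostIterate_le_expTail_zero n x hx

theorem norm_jostAmplitude_sub_one_le (h : KernelBound V k κ τ) {x : ℝ} (hx : 0 ≤ x) :
    ‖jostAmplitude V k x - 1‖ ≤ Real.exp (κ * expTail V τ x) - 1 := by
  have hamp := (h.summable_jostIterate hx).hasSum.sub (hasSum_ite_eq 0 (1 : ℂ))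
  have hexp := (hasSum_pow_expTail_div_factorial V κ τ x).sub (hasSum_ite_eq 0 (1 : ℝ))
  rw [jostAmplitude, ← hamp.tsum_eq]
  refine tsum_of_norm_bounded hexp fun n => ?_
  rcases n with _ | n
  · simp [jostIterate]
  · simpa using h.norm_jostIterate_le (n + 1) x hx

theorem tendsto_jostAmplitude (h : KernelBound V k κ τ) :
    Tendsto (jostAmplitude V k) atTop (𝓝 1) := by
  have htail : Tendsto (expTail V τ) atTop (𝓝 0) := tendsto_integral_Ioi_zero tendsto_id
  have hbound : Tendsto (fun x => Real.exp (κ * expTail V τ x) - 1) atTop (𝓝 0) := by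
    simpa using (htail.const_mul κ).rexp.sub_const 1
  rw [tendsto_iff_norm_sub_tendsto_zero]
  refine squeeze_zero' (.of_forall fun _ => norm_nonneg _) ?_ hbound
  filter_upwards [eventually_ge_atTop 0] with x hx
  exact h.norm_jostAmplitude_sub_one_le hx

theorem jostAmplitude_eq_one_add_jostTransform (h : KernelBound V k κ τ) {x : ℝ} (hx : 0 ≤ x) :
    jostAmplitude V k x = 1 + jostTransform V k (jostAmplitude V k) x := by
  have hbound := h.norm_jostIterate_le_expTail_zero
  have hint := fun n => h.integrableOn_jostKernel_mul (h.continuousOn_jostIterate n) (hbound n) hx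
  have hnorm : Summable fun n : ℕ =>
      ∫ ξ in Ioi 0, ‖jostKernel k (max (ξ - x) 0) * V ξ * jostIterate V k n ξ‖ :=
    .of_nonneg_of_le (fun n => integral_nonneg fun _ => norm_nonneg _)
      (fun n => h.integral_norm_jostKernel_mul_le (hbound n) hx)
      (((hasSum_pow_expTail_div_factorial V κ τ 0).summable.mul_left κ).mul_right _)
  have hsum := (hasSum_integral_of_summable_integral_norm hint hnorm).tsum_eq
  simp only [← jostTransform_eq_integral_Ioi_zero _ hx, ← jostIterate_succ, tsum_mul_left] at hsum
  calc jostAmplitude V k x = jostIterate V k 0 x + ∑' n, jostIterate V k (n + 1) x :=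
        (h.summable_jostIterate hx).tsum_eq_zero_add
    _ = 1 + jostTransform V k (jostAmplitude V k) x := by rw [hsum]; rfl

end KernelBound

end Volterra

/-! ### The Jost solution -/

/-- `∫_x^∞ e^{2ik(ξ - x)} V(ξ) m(ξ) dξ`, which is minus the derivative of `jostTransform V k m`. -/
noncomputable def jostSlope (V : ℝ → ℂ) (k : ℂ) (m : ℝ → ℂ) (x : ℝ) : ℂ :=
  Complex.exp (-(2 * Complex.I * k) * x) *
    ∫ ξ in Ioi x, Complex.exp (2 * Complex.I * k * ξ) * (V ξ * m ξ)

/-- The derivative in `x` of the Jost solution. -/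
noncomputable def jostDeriv (V : ℝ → ℂ) (k : ℂ) (x : ℝ) : ℂ :=
  Complex.I * k * jostSolution V x k -
    Complex.exp (Complex.I * k * x) * jostSlope V k (jostAmplitude V k) x

section Slope

variable {V : ℝ → ℂ} {k : ℂ} {m : ℝ → ℂ}

theorem integrableOn_exp_two_I_mul (hk : 0 ≤ k.im) {q : ℝ → ℂ} (hq : IntegrableOn q (Ioi 0)) :
    IntegrableOn (fun ξ : ℝ => Complex.exp (2 * Complex.I * k * ξ) * q ξ) (Ioi 0) :=
  Integrable.bdd_mul (c := 1) hq (Continuous.aestronglyMeasurable (by fun_prop))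
    (ae_restrict_of_forall_mem measurableSet_Ioi
      fun _ ht => norm_exp_two_I_mul_le_one hk (le_of_lt ht))

theorem isPrimitive_jostSlope (hk : 0 ≤ k.im) (hq : IntegrableOn (fun ξ => V ξ * m ξ) (Ioi 0)) :
    IsPrimitive (jostSlope V k m) (fun x => -(2 * Complex.I * k) * jostSlope V k m x - V x * m x) :=
  by
  have hmul := (isPrimitive_exp (-(2 * Complex.I * k))).mul
    (isPrimitive_integral_Ioi (integrableOn_exp_two_I_mul hk hq))
  refine hmul.congr_ae (ae_of_all _ fun x => ?_)
  have hexp : Complex.exp (-(2 * Complex.I * k) * x) * Complex.exp (2 * Complex.I * k * x) = 1 := by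
    rw [← Complex.exp_add]; simp
  simp only [jostSlope]
  linear_combination (-(V x * m x)) * hexp

theorem norm_jostSlope_le (hk : 0 ≤ k.im) (hq : IntegrableOn (fun ξ => V ξ * m ξ) (Ioi 0)) {x : ℝ}
    (hx : 0 ≤ x) : ‖jostSlope V k m x‖ ≤ ∫ ξ in Ioi 0, ‖V ξ * m ξ‖ := by
  have hqn : IntegrableOn (fun ξ => ‖V ξ * m ξ‖) (Ioi 0) := hq.norm
  rw [jostSlope, ← integral_const_mul]
  refine (norm_integral_le_of_norm_le (hqn.mono_set (Ioi_subset_Ioi hx))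
    (ae_restrict_of_forall_mem measurableSet_Ioi fun ξ (hξ : x < ξ) => ?_)).trans
    (setIntegral_mono_set hqn (ae_of_all _ fun _ => norm_nonneg _)
      (Ioi_subset_Ioi hx).eventuallyLE)
  have hphase : -(2 * Complex.I * k) * x + 2 * Complex.I * k * ξ =
      2 * Complex.I * k * ((ξ - x : ℝ) : ℂ) := by
    push_cast; ring
  rw [← mul_assoc, ← Complex.exp_add, hphase, norm_mul]
  exact mul_le_of_le_one_left (norm_nonneg _) (norm_exp_two_I_mul_le_one hk (sub_nonneg.2 hξ.le))

theorem jostTransform_zero_eq (hq : IntegrableOn (fun ξ => V ξ * m ξ) (Ioi 0))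
    (hid : IntegrableOn (fun ξ : ℝ => (ξ : ℂ) * (V ξ * m ξ)) (Ioi 0)) {x : ℝ} (hx : 0 ≤ x) :
    jostTransform V 0 m x =
      (∫ ξ in Ioi x, (ξ : ℂ) * (V ξ * m ξ)) - x * ∫ ξ in Ioi x, V ξ * m ξ := by
  rw [jostTransform, ← integral_const_mul, ← integral_sub (hid.mono_set (Ioi_subset_Ioi hx))
    ((hq.mono_set (Ioi_subset_Ioi hx)).const_mul _)]
  refine setIntegral_congr_fun measurableSet_Ioi fun ξ _ => ?_
  simp only [jostKernel, if_pos]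
  push_cast
  ring

theorem jostTransform_eq_of_ne_zero (hk : 0 ≤ k.im) (hk0 : k ≠ 0)
    (hq : IntegrableOn (fun ξ => V ξ * m ξ) (Ioi 0)) {x : ℝ} (hx : 0 ≤ x) :
    jostTransform V k m x =
      (2 * Complex.I * k)⁻¹ * (jostSlope V k m x - ∫ ξ in Ioi x, V ξ * m ξ) := by
  rw [jostTransform, jostSlope, ← integral_const_mul, ← integral_sub
    (((integrableOn_exp_two_I_mul hk hq).mono_set (Ioi_subset_Ioi hx)).const_mul _)
    (hq.mono_set (Ioi_subset_Ioi hx)), ← integral_const_mul]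
  refine setIntegral_congr_fun measurableSet_Ioi fun ξ _ => ?_
  have hexp : Complex.exp (2 * Complex.I * k * ((ξ - x : ℝ) : ℂ)) =
      Complex.exp (-(2 * Complex.I * k) * x) * Complex.exp (2 * Complex.I * k * ξ) := by
    rw [← Complex.exp_add]; congr 1; push_cast; ring
  simp only [jostKernel, if_neg hk0, hexp]
  field_simp

theorem isPrimitive_jostTransform_zero (hq : IntegrableOn (fun ξ => V ξ * m ξ) (Ioi 0))
    (hid : IntegrableOn (fun ξ : ℝ => (ξ : ℂ) * (V ξ * m ξ)) (Ioi 0)) :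
    IsPrimitive (jostTransform V 0 m) (fun x => -jostSlope V 0 m x) := by
  have hx : IsPrimitive (fun x : ℝ => (x : ℂ)) (fun _ => 1) :=
    isPrimitive_of_hasDerivWithinAt
      (fun _ _ => Complex.ofRealCLM.hasDerivAt.hasDerivWithinAt) continuousOn_const
  have hprim := (isPrimitive_integral_Ioi hid).sub (hx.mul (isPrimitive_integral_Ioi hq))
  refine (hprim.congr_left fun x hx => (jostTransform_zero_eq hq hid hx).symm).congr_ae
    (ae_of_all _ fun x => ?_)
  simp [jostSlope]

theorem isPrimitive_jostTransform_of_ne_zero (hk : 0 ≤ k.im) (hk0 : k ≠ 0)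
    (hq : IntegrableOn (fun ξ => V ξ * m ξ) (Ioi 0)) :
    IsPrimitive (jostTransform V k m) (fun x => -jostSlope V k m x) := by
  have hprim := ((isPrimitive_jostSlope hk hq).sub
    (isPrimitive_integral_Ioi hq)).const_mul (2 * Complex.I * k)⁻¹
  refine (hprim.congr_left fun x hx => (jostTransform_eq_of_ne_zero hk hk0 hq hx).symm).congr_ae
    (ae_of_all _ fun x => ?_)
  field_simp
  ring

end Slope

namespace KernelBound

variable {V : ℝ → ℂ} {k : ℂ} {κ τ : ℝ}

theorem integrableOn_mul_jostAmplitude (h : KernelBound V k κ τ) :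
    IntegrableOn (fun ξ => V ξ * jostAmplitude V k ξ) (Ioi 0) :=
  Integrable.mul_bdd (c := Real.exp (κ * expTail V τ 0))
    (h.expIntegrable.integrableOn h.rate_nonneg)
    ((h.continuousOn_jostAmplitude.mono Ioi_subset_Ici_self).aestronglyMeasurable
      measurableSet_Ioi)
    (ae_restrict_of_forall_mem measurableSet_Ioi
      fun _ ht => h.norm_jostAmplitude_le (le_of_lt ht))

theorem isPrimitive_jostAmplitude (h : KernelBound V k κ τ) (hk : 0 ≤ k.im) :
    IsPrimitive (jostAmplitude V k) (fun x => -jostSlope V k (jostAmplitude V k) x) := by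
  have hq := h.integrableOn_mul_jostAmplitude
  have hprim : IsPrimitive (jostTransform V k (jostAmplitude V k))
      (fun x => -jostSlope V k (jostAmplitude V k) x) := by
    rcases eq_or_ne k 0 with rfl | hk0
    · refine isPrimitive_jostTransform_zero hq ?_
      refine (h.integrableOn_jostKernel_mul h.continuousOn_jostAmplitude
        (fun _ => h.norm_jostAmplitude_le) le_rfl).congr_fun (fun ξ (hξ : 0 < ξ) => ?_)
        measurableSet_Ioi
      simp [jostKernel, max_eq_left hξ.le, mul_assoc]
    · exact isPrimitive_jostTransform_of_ne_zero hk hk0 hq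
  refine ⟨hprim.intervalIntegrable_zero, fun x hx => ?_⟩
  rw [h.jostAmplitude_eq_one_add_jostTransform hx,
    h.jostAmplitude_eq_one_add_jostTransform le_rfl, hprim.eq_add_integral x hx, add_assoc]

theorem isSolution_jostSolution (h : KernelBound V k κ τ) (hk : 0 ≤ k.im) :
    IsSolution (fun x => V x - k ^ 2) (fun x => jostSolution V x k) (jostDeriv V k) := by
  have hexp := isPrimitive_exp (Complex.I * k)
  have hsol : IsPrimitive (fun x => jostSolution V x k) (jostDeriv V k) := by
    refine (hexp.mul (h.isPrimitive_jostAmplitude hk)).congr_ae (ae_of_all _ fun x => ?_)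
    simp only [jostDeriv, jostSolution_eq]
    ring
  refine ⟨hsol, ((hsol.const_mul (Complex.I * k)).sub (hexp.mul
    (isPrimitive_jostSlope hk h.integrableOn_mul_jostAmplitude))).congr_ae
      (ae_of_all _ fun x => ?_)⟩
  simp only [jostDeriv, jostSolution_eq]
  linear_combination (k ^ 2 * Complex.exp (Complex.I * k * x) * jostAmplitude V k x) * Complex.I_sq

theorem norm_jostSolution_le (h : KernelBound V k κ τ) {x : ℝ} (hx : 0 ≤ x) :
    ‖jostSolution V x k‖ ≤ Real.exp (κ * expTail V τ 0) * Real.exp (-(k.im * x)) := by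
  rw [jostSolution_eq, norm_mul, norm_exp_I_mul, mul_comm]
  gcongr
  exact h.norm_jostAmplitude_le hx

theorem exists_norm_jostDeriv_le (h : KernelBound V k κ τ) (hk : 0 ≤ k.im) :
    ∃ C : ℝ, ∀ x : ℝ, 0 ≤ x → ‖jostDeriv V k x‖ ≤ C := by
  refine ⟨‖k‖ * Real.exp (κ * expTail V τ 0) + ∫ ξ in Ioi 0, ‖V ξ * jostAmplitude V k ξ‖,
    fun x hx => ?_⟩
  have hdecay : Real.exp (-(k.im * x)) ≤ 1 := Real.exp_le_one_iff.2 (by nlinarith)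
  refine (norm_sub_le _ _).trans ?_
  rw [norm_mul, norm_mul, norm_mul, Complex.norm_I, one_mul, norm_exp_I_mul]
  gcongr
  · exact (h.norm_jostSolution_le hx).trans (mul_le_of_le_one_right (Real.exp_pos _).le hdecay)
  · exact (mul_le_of_le_one_left (norm_nonneg _) hdecay).trans
      (norm_jostSlope_le hk h.integrableOn_mul_jostAmplitude hx)

end KernelBound

theorem ExpIntegrable.kernelBound {V : ℝ → ℂ} {a δ : ℝ} (hV : ExpIntegrable V a) (hδ : 0 < δ)
    (hδa : δ ≤ a) {k : ℂ} (hk : -(2 * k.im) ≤ a - δ) : KernelBound V k δ⁻¹ a :=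
  ⟨hδ.le.trans hδa, fun _ ht => norm_jostKernel_le_inv_mul_exp hδ hδa hk ht, hV⟩

theorem ExpIntegrable.kernelBound_of_im_nonneg {V : ℝ → ℂ} {a : ℝ} (hV : ExpIntegrable V a)
    (ha : 0 < a) {k : ℂ} (hk : 0 ≤ k.im) : KernelBound V k a⁻¹ a :=
  hV.kernelBound ha le_rfl (by linarith)

/-! ### Analyticity of the Jost function -/

theorem aestronglyMeasurable_deriv_of_ae_differentiableAt {α : Type*} [MeasurableSpace α]
    {μ : Measure α} {F : ℂ → α → ℂ} {k₀ : ℂ}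
    (hF : ∀ᵐ x ∂μ, DifferentiableAt ℂ (fun k => F k x) k₀)
    (hmeas : ∀ᶠ k in 𝓝 k₀, AEStronglyMeasurable (F k) μ) :
    AEStronglyMeasurable (fun x => deriv (fun k => F k x) k₀) μ := by
  obtain ⟨u, hu⟩ := exists_seq_tendsto (𝓝[≠] k₀)
  obtain ⟨N, hN⟩ := eventually_atTop.1 ((hu.mono_right nhdsWithin_le_nhds).eventually hmeas)
  refine aestronglyMeasurable_of_tendsto_ae (u := atTop)
    (f := fun n x => slope (fun k => F k x) k₀ (u (n + N))) (fun n => ?_) ?_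
  · simp only [slope_def_field]
    exact ((hN _ (Nat.le_add_left N n)).sub hmeas.self_of_nhds).mul aestronglyMeasurable_const
  · filter_upwards [hF] with x hx
    exact (hx.hasDerivAt.tendsto_slope.comp hu).comp (tendsto_add_atTop_nat N)

theorem differentiableOn_integral_of_dominated {α : Type*} [MeasurableSpace α] {μ : Measure α}
    {F : ℂ → α → ℂ} {U : Set ℂ} {bound : α → ℝ} (hU : IsOpen U)
    (hF : ∀ᵐ x ∂μ, DifferentiableOn ℂ (fun k => F k x) U)
    (hmeas : ∀ k ∈ U, AEStronglyMeasurable (F k) μ)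
    (hbound : ∀ᵐ x ∂μ, ∀ k ∈ U, ‖F k x‖ ≤ bound x) (hint : Integrable bound μ) :
    DifferentiableOn ℂ (fun k => ∫ x, F k x ∂μ) U := by
  intro k₀ hk₀
  obtain ⟨ε, hε, hball⟩ := Metric.isOpen_iff.1 hU k₀ hk₀
  have hρ : 0 < ε / 2 := by positivity
  have hdisc : ∀ k ∈ Metric.ball k₀ (ε / 2), Metric.closedBall k (ε / 2) ⊆ U := fun k hk =>
    (Metric.closedBall_subset_ball' (by linarith [Metric.mem_ball.1 hk])).trans hball
  have hdiff : ∀ᵐ x ∂μ, ∀ k ∈ U, DifferentiableAt ℂ (fun k => F k x) k :=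
    hF.mono fun x hx k hk => (hx k hk).differentiableAt (hU.mem_nhds hk)
  have hmeas_nhds := eventually_of_mem (hU.mem_nhds hk₀) hmeas
  have hcauchy : ∀ᵐ x ∂μ, ∀ k ∈ Metric.ball k₀ (ε / 2),
      ‖deriv (fun k => F k x) k‖ ≤ bound x / (ε / 2) := by
    filter_upwards [hF, hbound] with x hx hb k hk
    refine Complex.norm_deriv_le_of_forall_mem_sphere_norm_le hρ (hx.mono ?_).diffContOnCl
      fun w hw => hb w (hdisc k hk (Metric.sphere_subset_closedBall hw))
    rw [closure_ball _ hρ.ne']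
    exact hdisc k hk
  exact (hasDerivAt_integral_of_dominated_loc_of_deriv_le (Metric.ball_mem_nhds k₀ hρ) hmeas_nhds
    (Integrable.mono' hint (hmeas k₀ hk₀) (hbound.mono fun x hx => hx k₀ hk₀))
    (aestronglyMeasurable_deriv_of_ae_differentiableAt (hdiff.mono fun x hx => hx k₀ hk₀)
      hmeas_nhds) hcauchy (hint.div_const _)
    (hdiff.mono fun x hx k hk => (hx k (hdisc k hk
      (Metric.mem_closedBall_self hρ.le))).hasDerivAt)).2.differentiableAt.differentiableWithinAt

section Holomorphy

variable {V : ℝ → ℂ} {κ τ : ℝ} {U : Set ℂ}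

theorem differentiableOn_jostTransform (hU : IsOpen U) (h : ∀ k ∈ U, KernelBound V k κ τ)
    {m : ℂ → ℝ → ℂ} {C : ℝ} (hm : ∀ x, 0 ≤ x → DifferentiableOn ℂ (fun k => m k x) U)
    (hcont : ∀ k ∈ U, ContinuousOn (m k) (Ici 0)) (hC : ∀ k ∈ U, ∀ x, 0 ≤ x → ‖m k x‖ ≤ C)
    {x : ℝ} (hx : 0 ≤ x) : DifferentiableOn ℂ (fun k => jostTransform V k (m k) x) U := by
  rcases U.eq_empty_or_nonempty with rfl | ⟨k₀, hk₀⟩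
  · exact differentiableOn_empty
  have hV := (h k₀ hk₀).expIntegrable
  refine DifferentiableOn.congr ?_ fun k _ => jostTransform_eq_integral_Ioi_zero (m k) hx
  refine differentiableOn_integral_of_dominated hU
    (bound := fun ξ => κ * C * (Real.exp (τ * ξ) * ‖V ξ‖))
    (ae_restrict_of_forall_mem measurableSet_Ioi fun ξ hξ => ?_)
    (fun k hk => aestronglyMeasurable_jostKernel_mul hV.aestronglyMeasurable (hcont k hk) x)
    (ae_restrict_of_forall_mem measurableSet_Ioi fun ξ hξ k hk =>
      (h k hk).norm_jostKernel_mul_le hx (le_of_lt hξ) (hC k hk ξ (le_of_lt hξ)))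
    (hV.integrableOn_exp_mul_norm.const_mul _)
  exact ((differentiable_jostKernel _).differentiableOn.mul_const _).mul (hm ξ (le_of_lt hξ))

theorem differentiableOn_jostIterate (hU : IsOpen U) (h : ∀ k ∈ U, KernelBound V k κ τ) (n : ℕ) :
    ∀ x : ℝ, 0 ≤ x → DifferentiableOn ℂ (fun k => jostIterate V k n x) U := by
  induction n with
  | zero => exact fun x _ => differentiableOn_const _
  | succ n ih =>
    exact fun x hx => differentiableOn_jostTransform hU h ih
      (fun k hk => (h k hk).continuousOn_jostIterate n)
      (fun k hk => (h k hk).norm_jostIterate_le_expTail_zero n) hx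

theorem jostFunction_eq_jostAmplitude (V : ℝ → ℂ) (k : ℂ) :
    jostFunction V k = jostAmplitude V k 0 := by
  simp [jostFunction, jostSolution_eq]

theorem differentiableOn_jostFunction (hU : IsOpen U) (h : ∀ k ∈ U, KernelBound V k κ τ) :
    DifferentiableOn ℂ (jostFunction V) U := by
  rw [funext (jostFunction_eq_jostAmplitude V)]
  exact Complex.differentiableOn_tsum_of_summable_norm
    (hasSum_pow_expTail_div_factorial V κ τ 0).summable
    (fun n => differentiableOn_jostIterate hU h n 0 le_rfl) hU
    fun n k hk => (h k hk).norm_jostIterate_le n 0 le_rfl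

theorem ExpIntegrable.analyticOnNhd_jostFunction {a : ℝ} (hV : ExpIntegrable V a) (ha : 0 < a) :
    AnalyticOnNhd ℂ (jostFunction V) {k : ℂ | -(2 * k.im) < a} := by
  have hopen : ∀ c : ℝ, IsOpen {k : ℂ | -(2 * k.im) < c} := fun c =>
    isOpen_lt (by fun_prop) continuous_const
  refine DifferentiableOn.analyticOnNhd (fun k₀ (hk₀ : -(2 * k₀.im) < a) => ?_) (hopen a)
  obtain ⟨δ, hδ, hδa, hk⟩ : ∃ δ, 0 < δ ∧ δ ≤ a ∧ -(2 * k₀.im) < a - δ := by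
    refine ⟨min a ((a + 2 * k₀.im) / 2), lt_min ha (by linarith), min_le_left _ _, ?_⟩
    linarith [min_le_right a ((a + 2 * k₀.im) / 2)]
  exact ((differentiableOn_jostFunction (hopen (a - δ)) fun k hk' =>
    hV.kernelBound hδ hδa (le_of_lt hk')).differentiableAt
      ((hopen _).mem_nhds hk)).differentiableWithinAt

end Holomorphy

/-! ### Eigenfunctions and Green's identity -/

theorem not_integrableOn_Ioi_of_eventually_le {f : ℝ → ℝ} {c : ℝ} (hc : 0 < c)
    (hf : ∀ᶠ x in atTop, c ≤ f x) : ¬IntegrableOn f (Ioi 0) := by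
  intro hfi
  obtain ⟨X, hX⟩ := eventually_atTop.1 hf
  have hconst : IntegrableOn (fun _ : ℝ => c) (Ioi (max X 0)) := by
    refine Integrable.mono' (hfi.mono_set (Ioi_subset_Ioi (le_max_right X 0)))
      aestronglyMeasurable_const (ae_restrict_of_forall_mem measurableSet_Ioi
        fun x (hx : max X 0 < x) => ?_)
    rw [Real.norm_of_nonneg hc.le]
    exact hX x ((le_max_left X 0).trans hx.le)
  simp [integrableOn_const_iff, hc.ne'] at hconst

theorem IsPrimitive.tendsto_norm_atTop {E : Type*} [NormedAddCommGroup E] [NormedSpace ℝ E]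
    [CompleteSpace E] {F f : ℝ → E} (hF : IsPrimitive F f) {g : ℝ → ℝ} {c : ℝ} {w : E}
    (hg : IntegrableOn g (Ioi 0)) (hc : c < ‖w‖) (hf : ∀ᶠ t in atTop, ‖w - f t‖ ≤ c + g t) :
    Tendsto (fun x => ‖F x‖) atTop atTop := by
  obtain ⟨X, hX0, hX⟩ := (atTop_basis' (0 : ℝ)).eventually_iff.1 hf
  have hgn : IntegrableOn (fun t => ‖g t‖) (Ioi 0) := hg.norm
  have hlin : Tendsto (fun R => (‖w‖ - c) * (R - X) - ((∫ t in Ioi 0, ‖g t‖) + ‖F X‖))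
      atTop atTop :=
    tendsto_atTop_add_const_right _ _
      ((tendsto_atTop_add_const_right _ _ tendsto_id).const_mul_atTop (sub_pos.2 hc))
  refine tendsto_atTop_mono' _ ?_ hlin
  filter_upwards [eventually_ge_atTop X] with R hR
  have hsub : Ioc X R ⊆ Ioi 0 := fun t ht => hX0.trans_lt ht.1
  have hgi : IntervalIntegrable g volume X R :=
    (intervalIntegrable_iff_integrableOn_Ioc_of_le hR).2 (hg.mono_set hsub)
  have hgle : ∫ t in X..R, g t ≤ ∫ t in Ioi 0, ‖g t‖ := by
    rw [intervalIntegral.integral_of_le hR]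
    exact (Real.le_norm_self _).trans <| (norm_integral_le_integral_norm _).trans <|
      setIntegral_mono_set hgn (ae_of_all _ fun _ => norm_nonneg _) hsub.eventuallyLE
  have hdist : ‖(R - X) • w - (F R - F X)‖ ≤ c * (R - X) + ∫ t in X..R, g t := by
    rw [← hF.integral_eq_sub hX0 (hX0.trans hR), ← intervalIntegral.integral_const,
      ← intervalIntegral.integral_sub intervalIntegrable_const
        (hF.intervalIntegrable hX0 (hX0.trans hR))]
    refine (intervalIntegral.norm_integral_le_of_norm_le hR
      (ae_of_all _ fun t ht => hX ht.1.le) (intervalIntegrable_const.add hgi)).trans_eq ?_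
    rw [intervalIntegral.integral_add intervalIntegrable_const hgi,
      intervalIntegral.integral_const, smul_eq_mul, mul_comm]
  have hwR : ‖(R - X) • w‖ = (R - X) * ‖w‖ := by
    rw [norm_smul, Real.norm_of_nonneg (sub_nonneg.2 hR)]
  linarith [norm_sub_norm_le ((R - X) • w) (F R - F X), norm_sub_le (F R) (F X)]

theorem two_mul_mul_le_add_sq (s C : ℝ) {ε : ℝ} (hε : 0 < ε) :
    2 * (s * C) ≤ ε + C ^ 2 / ε * s ^ 2 := by
  have hsq : ε + C ^ 2 / ε * s ^ 2 - 2 * (s * C) = (ε - C * s) ^ 2 / ε := by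
    field_simp
    ring
  linarith [show 0 ≤ (ε - C * s) ^ 2 / ε by positivity]

-- Writing `W = z E - y Z`, one has `(y E)' = W + 2 y Z`; if `W` had a limit `w ≠ 0`, then `y E`
-- would grow linearly, since `|2 y Z| ≤ |w|/4 + const |y|²`.
theorem IsPrimitive.eq_zero_of_tendsto_wronskian {y z E Z : ℝ → ℂ} {C D : ℝ} {w : ℂ}
    (hy : IsPrimitive y z) (hE : IsPrimitive E Z) (hEC : ∀ x, 0 ≤ x → ‖E x‖ ≤ C)
    (hZD : ∀ x, 0 ≤ x → ‖Z x‖ ≤ D) (hy2 : IntegrableOn (fun x => ‖y x‖ ^ 2) (Ioi 0))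
    (hw : Tendsto (fun x => z x * E x - y x * Z x) atTop (𝓝 w)) : w = 0 := by
  by_contra hw0
  have hε : 0 < ‖w‖ / 4 := by positivity
  have hderiv : ∀ᶠ t in atTop, ‖w - (z t * E t + y t * Z t)‖ ≤
      ‖w‖ / 2 + D ^ 2 / (‖w‖ / 4) * ‖y t‖ ^ 2 := by
    filter_upwards [(tendsto_iff_norm_sub_tendsto_zero.1 hw).eventually (gt_mem_nhds hε),
      eventually_ge_atTop 0] with t hWt ht
    have hyZ : ‖2 * (y t * Z t)‖ ≤ ‖w‖ / 4 + D ^ 2 / (‖w‖ / 4) * ‖y t‖ ^ 2 := by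
      rw [norm_mul, norm_mul, Complex.norm_ofNat]
      exact (by gcongr; exact hZD t ht : _ ≤ 2 * (‖y t‖ * D)).trans
        (two_mul_mul_le_add_sq _ _ hε)
    have hsplit : w - (z t * E t + y t * Z t) =
        -((z t * E t - y t * Z t) - w) - 2 * (y t * Z t) := by ring
    rw [hsplit]
    refine (norm_sub_le _ _).trans ?_
    rw [norm_neg]
    linarith
  have hgrow : Tendsto (fun x => ‖y x * E x‖) atTop atTop :=
    (hy.mul hE).tendsto_norm_atTop (hy2.const_mul _) (half_lt_self (norm_pos_iff.2 hw0)) hderiv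
  refine not_integrableOn_Ioi_of_eventually_le one_pos ?_ (hy2.const_mul (C ^ 2))
  filter_upwards [hgrow.eventually_ge_atTop 1, eventually_ge_atTop 0] with x hx hx0
  calc (1 : ℝ) ≤ ‖y x * E x‖ ^ 2 := one_le_pow₀ hx
    _ = ‖E x‖ ^ 2 * ‖y x‖ ^ 2 := by rw [norm_mul]; ring
    _ ≤ C ^ 2 * ‖y x‖ ^ 2 := by gcongr; exact hEC x hx0

section HalfLineL2

variable {V : ℝ → ℂ} {μ : ℂ} {u f : HalfLineL2} {y : ℝ → ℂ}

theorem IsDirichletPair.exists_isPrimitive (h : IsDirichletPair V u f) :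
    ∃ y z : ℝ → ℂ, u =ᵐ[volume.restrict (Ioi 0)] y ∧ y 0 = 0 ∧ IsPrimitive y z ∧
      IsPrimitive z (fun t => V t * y t - f t) := by
  obtain ⟨y, z, hu, hy0, hderiv, hVy, hz⟩ := h
  have hzprim : IsPrimitive z (fun t => V t * y t - f t) :=
    ⟨fun x hx => (hVy x hx).sub (intervalIntegrable_coe f x hx), hz⟩
  exact ⟨y, z, hu, hy0, isPrimitive_of_hasDerivWithinAt hderiv hzprim.continuousOn, hzprim⟩

theorem IsDirichletPair.exists_isSolution (h : IsDirichletPair V u (μ • u)) :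
    ∃ y z : ℝ → ℂ, u =ᵐ[volume.restrict (Ioi 0)] y ∧ y 0 = 0 ∧
      IsSolution (fun x => V x - μ) y z := by
  obtain ⟨y, z, hu, hy0, hy, hz⟩ := h.exists_isPrimitive
  refine ⟨y, z, hu, hy0, hy, hz.congr_ae ?_⟩
  filter_upwards [hu, Lp.coeFn_smul μ u] with x hux hsmul
  rw [hsmul, Pi.smul_apply, hux, smul_eq_mul, sub_mul]

theorem integrableOn_sq_norm_of_ae_eq (hu : u =ᵐ[volume.restrict (Ioi 0)] y) :
    IntegrableOn (fun x => ‖y x‖ ^ 2) (Ioi 0) := by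
  have hy : MemLp y 2 (volume.restrict (Ioi (0 : ℝ))) := (memLp_congr_ae hu).1 (Lp.memLp u)
  exact (memLp_two_iff_integrable_sq_norm hy.1).1 hy

theorem eq_zero_of_ae_eq_of_forall_eq_zero (hu : u =ᵐ[volume.restrict (Ioi 0)] y)
    (hy : ∀ x, 0 ≤ x → y x = 0) : u = 0 :=
  Lp.eq_zero_iff_ae_eq_zero.2 <| hu.trans <|
    ae_restrict_of_forall_mem measurableSet_Ioi fun x hx => hy x (le_of_lt hx)

theorem integrableOn_norm_mul_exp (u : HalfLineL2) {η : ℝ} (hη : 0 < η) (C : ℝ) :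
    IntegrableOn (fun x => ‖u x‖ * (C * Real.exp (-(η * x)))) (Ioi 0) := by
  have hexp : MemLp (fun x : ℝ => C * Real.exp (-(η * x))) 2 (volume.restrict (Ioi (0 : ℝ))) := by
    rw [memLp_two_iff_integrable_sq (Continuous.aestronglyMeasurable (by fun_prop))]
    refine ((integrableOn_exp_mul_Ioi (a := -(2 * η)) (by linarith) 0).const_mul (C ^ 2)).congr
      (ae_of_all _ fun x => ?_)
    simp only [mul_pow, ← Real.exp_nat_mul]
    congr 2
    push_cast
    ring
  exact (Lp.memLp u).norm.integrable_mul hexp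

end HalfLineL2

/-- The pairing `∫ u e(·, k)` of an `L²` function with the Jost solution. -/
noncomputable def jostPairing (V : ℝ → ℂ) (u : HalfLineL2) (k : ℂ) : ℂ :=
  ∫ x in Ioi (0 : ℝ), u x * jostSolution V x k

theorem jostPairing_smul (V : ℝ → ℂ) (μ : ℂ) (u : HalfLineL2) (k : ℂ) :
    jostPairing V (μ • u) k = μ * jostPairing V u k := by
  rw [jostPairing, jostPairing, ← integral_const_mul]
  refine integral_congr_ae ?_
  filter_upwards [Lp.coeFn_smul μ u] with x hx
  rw [hx, Pi.smul_apply, smul_eq_mul, mul_assoc]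

namespace ExpIntegrable

variable {V : ℝ → ℂ} {a : ℝ} {k μ : ℂ}

theorem norm_mul_jostSolution_le (hV : ExpIntegrable V a) (ha : 0 < a) (u : HalfLineL2) {η : ℝ}
    (hη : 0 ≤ η) (hk : η ≤ k.im) {x : ℝ} (hx : 0 ≤ x) : ‖u x * jostSolution V x k‖ ≤
      ‖u x‖ * (Real.exp (a⁻¹ * expTail V a 0) * Real.exp (-(η * x))) := by
  rw [norm_mul]
  gcongr
  refine ((hV.kernelBound_of_im_nonneg ha (hη.trans hk)).norm_jostSolution_le hx).trans ?_
  gcongr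

theorem integrableOn_mul_jostSolution (hV : ExpIntegrable V a) (ha : 0 < a) (u : HalfLineL2)
    (hk : 0 < k.im) : IntegrableOn (fun x => u x * jostSolution V x k) (Ioi 0) := by
  have hsol := (hV.kernelBound_of_im_nonneg ha hk.le).isSolution_jostSolution hk.le
  exact Integrable.mono' (integrableOn_norm_mul_exp u hk (Real.exp (a⁻¹ * expTail V a 0)))
    ((Lp.aestronglyMeasurable u).mul
      ((hsol.isPrimitive.continuousOn.mono Ioi_subset_Ici_self).aestronglyMeasurable
        measurableSet_Ioi))
    (ae_restrict_of_forall_mem measurableSet_Ioi fun _ hx =>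
      hV.norm_mul_jostSolution_le ha u hk.le le_rfl (le_of_lt hx))

theorem exists_norm_jostPairing_le (hV : ExpIntegrable V a) (ha : 0 < a) (u : HalfLineL2) {η : ℝ}
    (hη : 0 < η) : ∃ B : ℝ, ∀ k : ℂ, η ≤ k.im → ‖jostPairing V u k‖ ≤ B :=
  ⟨_, fun _ hk => norm_integral_le_of_norm_le
    (integrableOn_norm_mul_exp u hη (Real.exp (a⁻¹ * expTail V a 0)))
    (ae_restrict_of_forall_mem measurableSet_Ioi fun _ hx =>
      hV.norm_mul_jostSolution_le ha u hη.le hk (le_of_lt hx))⟩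

theorem jostPairing_sub (hV : ExpIntegrable V a) (ha : 0 < a) (hk : 0 < k.im)
    (f u : HalfLineL2) : jostPairing V (f - u) k = jostPairing V f k - jostPairing V u k := by
  rw [jostPairing, jostPairing, jostPairing, ← integral_sub
    (hV.integrableOn_mul_jostSolution ha f hk) (hV.integrableOn_mul_jostSolution ha u hk)]
  refine integral_congr_ae ?_
  filter_upwards [Lp.coeFn_sub f u] with x hx
  rw [hx, Pi.sub_apply, sub_mul]

theorem eq_zero_of_tendsto_wronskian (hV : ExpIntegrable V a) (ha : 0 < a) (hk : 0 ≤ k.im)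
    {y z : ℝ → ℂ} {w : ℂ} (hy : IsPrimitive y z)
    (hy2 : IntegrableOn (fun x => ‖y x‖ ^ 2) (Ioi 0))
    (hw : Tendsto (fun x => z x * jostSolution V x k - y x * jostDeriv V k x) atTop (𝓝 w)) :
    w = 0 := by
  have hker := hV.kernelBound_of_im_nonneg ha hk
  obtain ⟨D, hD⟩ := hker.exists_norm_jostDeriv_le hk
  refine hy.eq_zero_of_tendsto_wronskian (hker.isSolution_jostSolution hk).isPrimitive
    (fun x hx => (hker.norm_jostSolution_le hx).trans (mul_le_of_le_one_right
      (Real.exp_pos _).le (Real.exp_le_one_iff.2 (by nlinarith)))) hD hy2 hw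

theorem isPrimitive_wronskian (hV : ExpIntegrable V a) (ha : 0 < a) (hk : 0 ≤ k.im)
    {y z f : ℝ → ℂ} (hy : IsPrimitive y z) (hz : IsPrimitive z (fun t => V t * y t - f t)) :
    IsPrimitive (fun x => z x * jostSolution V x k - y x * jostDeriv V k x)
      (fun x => (k ^ 2 * y x - f x) * jostSolution V x k) := by
  obtain ⟨hE, hZ⟩ := (hV.kernelBound_of_im_nonneg ha hk).isSolution_jostSolution hk
  exact ((hz.mul hE).sub (hy.mul hZ)).congr_ae (ae_of_all _ fun x => by ring)

theorem jostPairing_eq_of_isPrimitive (hV : ExpIntegrable V a) (ha : 0 < a) (hk : 0 < k.im)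
    {u f : HalfLineL2} {y z : ℝ → ℂ} (hu : u =ᵐ[volume.restrict (Ioi 0)] y) (hy0 : y 0 = 0)
    (hy : IsPrimitive y z) (hz : IsPrimitive z (fun t => V t * y t - f t)) :
    jostPairing V f k = z 0 * jostFunction V k + k ^ 2 * jostPairing V u k := by
  have hui := (hV.integrableOn_mul_jostSolution ha u hk).const_mul (k ^ 2)
  have hfi := hV.integrableOn_mul_jostSolution ha f hk
  have hae : (fun x => k ^ 2 * (u x * jostSolution V x k) - f x * jostSolution V x k)
      =ᵐ[volume.restrict (Ioi 0)] fun x => (k ^ 2 * y x - f x) * jostSolution V x k := by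
    filter_upwards [hu] with x hx
    rw [hx]
    ring
  have hint : ∫ x in Ioi 0, (k ^ 2 * y x - f x) * jostSolution V x k =
      k ^ 2 * jostPairing V u k - jostPairing V f k := by
    rw [← integral_congr_ae hae, integral_sub hui hfi, integral_const_mul]
    rfl
  have hW := hV.isPrimitive_wronskian ha hk.le hy hz
  have hlim : Tendsto (fun x => z x * jostSolution V x k - y x * jostDeriv V k x) atTop
      (𝓝 (z 0 * jostSolution V 0 k - y 0 * jostDeriv V k 0 +
        ∫ x in Ioi 0, (k ^ 2 * y x - f x) * jostSolution V x k)) := by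
    refine ((intervalIntegral_tendsto_integral_Ioi 0 ((hui.sub hfi).congr hae)
      tendsto_id).const_add _).congr' ?_
    filter_upwards [eventually_ge_atTop 0] with x hx
    exact (hW.eq_add_integral x hx).symm
  have hzero := hV.eq_zero_of_tendsto_wronskian ha hk.le hy (integrableOn_sq_norm_of_ae_eq hu) hlim
  rw [hint, hy0] at hzero
  rw [jostFunction]
  linear_combination -hzero

theorem intervalIntegrable_sub_const (hV : ExpIntegrable V a) (ha : 0 < a) (μ : ℂ) (x : ℝ)
    (hx : 0 ≤ x) : IntervalIntegrable (fun t => V t - μ) volume 0 x :=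
  (hV.intervalIntegrable ha.le hx).sub intervalIntegrable_const

theorem exists_eigenfunction (hV : ExpIntegrable V a) (ha : 0 < a) {u : HalfLineL2}
    (hu : IsDirichletPair V u (μ • u)) (hu0 : u ≠ 0) :
    ∃ y z : ℝ → ℂ, u =ᵐ[volume.restrict (Ioi 0)] y ∧ y 0 = 0 ∧ z 0 ≠ 0 ∧
      IsSolution (fun x => V x - μ) y z := by
  obtain ⟨y, z, huy, hy0, hsol⟩ := hu.exists_isSolution
  exact ⟨y, z, huy, hy0, fun hz0 => hu0 <| eq_zero_of_ae_eq_of_forall_eq_zero huy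
    fun x hx => hsol.eq_zero (hV.intervalIntegrable_sub_const ha μ) hy0 hz0 hx, hsol⟩

theorem exists_jostPairing_eq (hV : ExpIntegrable V a) (ha : 0 < a) {u f : HalfLineL2}
    (huf : IsDirichletPair V u f) : ∃ d : ℂ, ∀ k : ℂ, 0 < k.im →
      jostPairing V f k = d * jostFunction V k + k ^ 2 * jostPairing V u k := by
  obtain ⟨y, z, hu, hy0, hy, hz⟩ := huf.exists_isPrimitive
  exact ⟨z 0, fun k hk => hV.jostPairing_eq_of_isPrimitive ha hk hu hy0 hy hz⟩

theorem exists_jostPairing_eq_of_eigenvector (hV : ExpIntegrable V a) (ha : 0 < a)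
    {u : HalfLineL2} (hu : IsDirichletPair V u (μ • u)) (hu0 : u ≠ 0) :
    ∃ d : ℂ, d ≠ 0 ∧ ∀ k : ℂ, 0 < k.im →
      (k ^ 2 - μ) * jostPairing V u k = d * jostFunction V k := by
  obtain ⟨y, z, huy, hy0, hz0, hsol⟩ := hV.exists_eigenfunction ha hu hu0
  refine ⟨-z 0, neg_ne_zero.2 hz0, fun k hk => ?_⟩
  have hz : IsPrimitive z (fun t => V t * y t - (μ • u : HalfLineL2) t) := by
    refine hsol.isPrimitive_deriv.congr_ae ?_
    filter_upwards [huy, Lp.coeFn_smul μ u] with x hux hsmul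
    rw [hsmul, Pi.smul_apply, hux, smul_eq_mul, sub_mul]
  have hgreen := hV.jostPairing_eq_of_isPrimitive ha hk huy hy0 hsol.isPrimitive hz
  rw [jostPairing_smul] at hgreen
  linear_combination -hgreen

theorem tendsto_norm_jostSolution (hV : ExpIntegrable V a) (ha : 0 < a) (hk : k.im = 0) :
    Tendsto (fun x => ‖jostSolution V x k‖) atTop (𝓝 1) := by
  have hlim := (hV.kernelBound_of_im_nonneg ha hk.ge).tendsto_jostAmplitude.norm
  rw [norm_one] at hlim
  refine hlim.congr fun x => ?_
  rw [jostSolution_eq, norm_mul, norm_exp_I_mul, hk]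
  simp

theorem jostFunction_eq_zero_of_eigenfunction (hV : ExpIntegrable V a) (ha : 0 < a)
    (hk : 0 ≤ k.im) {y z : ℝ → ℂ} (hy0 : y 0 = 0) (hz0 : z 0 ≠ 0)
    (hsol : IsSolution (fun x => V x - k ^ 2) y z)
    (hy2 : IntegrableOn (fun x => ‖y x‖ ^ 2) (Ioi 0)) : jostFunction V k = 0 := by
  have hW := hV.isPrimitive_wronskian ha hk (f := fun t => k ^ 2 * y t) hsol.isPrimitive
    (hsol.isPrimitive_deriv.congr_ae (ae_of_all _ fun t => sub_mul _ _ _))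
  have hconst : Tendsto (fun x => z x * jostSolution V x k - y x * jostDeriv V k x) atTop
      (𝓝 (z 0 * jostFunction V k)) := by
    refine tendsto_const_nhds.congr' ?_
    filter_upwards [eventually_ge_atTop 0] with x hx
    simpa [hy0, jostFunction] using (hW.eq_add_integral x hx).symm
  exact (mul_eq_zero.1 (hV.eq_zero_of_tendsto_wronskian ha hk hsol.isPrimitive hy2
    hconst)).resolve_left hz0

-- An eigenfunction would be proportional to the Jost solution, whose modulus tends to `1`.
theorem eq_zero_of_isDirichletPair_of_im_eq_zero (hV : ExpIntegrable V a) (ha : 0 < a)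
    (hk : k.im = 0) {u : HalfLineL2} (hu : IsDirichletPair V u (k ^ 2 • u)) : u = 0 := by
  by_contra hu0
  obtain ⟨y, z, huy, hy0, hz0, hsol⟩ := hV.exists_eigenfunction ha hu hu0
  have hy2 := integrableOn_sq_norm_of_ae_eq huy
  have hzero := hV.jostFunction_eq_zero_of_eigenfunction ha hk.ge hy0 hz0 hsol hy2
  have hprop : ∀ x, 0 ≤ x → z 0 * jostSolution V x k = jostDeriv V k 0 * y x := fun x hx =>
    ((hV.kernelBound_of_im_nonneg ha hk.ge).isSolution_jostSolution hk.ge).mul_eq_mul hsol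
      (hV.intervalIntegrable_sub_const ha _) hzero hy0 hx
  have hlim := ((hV.tendsto_norm_jostSolution ha hk).const_mul ‖z 0‖).pow 2
  have hpos : 0 < (‖z 0‖ * 1) ^ 2 := by positivity
  refine not_integrableOn_Ioi_of_eventually_le (half_pos hpos) ?_
    (hy2.const_mul (‖jostDeriv V k 0‖ ^ 2))
  filter_upwards [hlim.eventually (lt_mem_nhds (half_lt_self hpos)), eventually_ge_atTop 0]
    with x hx hx0
  rw [← mul_pow, ← norm_mul, ← hprop x hx0, norm_mul]
  exact hx.le

theorem exists_smul_eq_of_eigenvector (hV : ExpIntegrable V a) (ha : 0 < a) {u v : HalfLineL2}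
    (hu : IsDirichletPair V u (μ • u)) (hv : IsDirichletPair V v (μ • v)) (hu0 : u ≠ 0) :
    ∃ c : ℂ, c • u = v := by
  obtain ⟨y₁, z₁, hu₁, hy₁, hz₁, hsol₁⟩ := hV.exists_eigenfunction ha hu hu0
  obtain ⟨y₂, z₂, hv₂, hy₂, hsol₂⟩ := hv.exists_isSolution
  refine ⟨z₂ 0 / z₁ 0, Lp.ext ?_⟩
  filter_upwards [Lp.coeFn_smul (z₂ 0 / z₁ 0) u, hu₁, hv₂, ae_restrict_mem measurableSet_Ioi]
    with x hsmul hux hvx (hx : 0 < x)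
  rw [hsmul, Pi.smul_apply, hux, hvx, smul_eq_mul, div_mul_eq_mul_div,
    hsol₁.mul_eq_mul hsol₂ (hV.intervalIntegrable_sub_const ha μ) hy₁ hy₂ hx.le,
    mul_div_cancel_left₀ _ hz₁]

end ExpIntegrable

/-! ### Algebraic multiplicities and orders of zeros -/

theorem natCast_le_analyticOrderAt_of_isBigO {𝕜 E : Type*} [NontriviallyNormedField 𝕜]
    [NormedAddCommGroup E] [NormedSpace 𝕜 E] {f : 𝕜 → E} {z₀ : 𝕜} (hf : AnalyticAt 𝕜 f z₀) {n : ℕ}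
    (h : f =O[𝓝 z₀] fun z => (z - z₀) ^ n) : (n : ℕ∞) ≤ analyticOrderAt f z₀ := by
  by_contra hlt
  push Not at hlt
  obtain ⟨m, hm⟩ := ENat.ne_top_iff_exists.1 hlt.ne_top
  rw [← hm, Nat.cast_lt] at hlt
  obtain ⟨g, hg, hg0, hfg⟩ := hf.analyticOrderAt_eq_natCast.1 hm.symm
  obtain ⟨C, hC⟩ := h.bound
  have hright : Tendsto (fun z => C * ‖z - z₀‖ ^ (n - m)) (𝓝[≠] z₀) (𝓝 0) := by
    have hcont : Continuous fun z : 𝕜 => C * ‖z - z₀‖ ^ (n - m) := by fun_prop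
    simpa [zero_pow (Nat.sub_ne_zero_of_lt hlt)] using
      (hcont.tendsto z₀).mono_left (nhdsWithin_le_nhds (s := {z₀}ᶜ))
  refine hg0 (norm_le_zero_iff.1 (le_of_tendsto_of_tendsto
    (hg.continuousAt.norm.mono_left nhdsWithin_le_nhds) hright ?_))
  filter_upwards [hfg.filter_mono nhdsWithin_le_nhds, hC.filter_mono nhdsWithin_le_nhds,
    self_mem_nhdsWithin] with z hfz hCz hz
  have hpos : 0 < ‖z - z₀‖ ^ m := pow_pos (norm_pos_iff.2 (sub_ne_zero.2 hz)) m
  refine le_of_mul_le_mul_left ?_ hpos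
  calc ‖z - z₀‖ ^ m * ‖g z‖ = ‖f z‖ := by rw [hfz, norm_smul, norm_pow]
    _ ≤ C * ‖(z - z₀) ^ n‖ := hCz
    _ = ‖z - z₀‖ ^ m * (C * ‖z - z₀‖ ^ (n - m)) := by
      rw [norm_pow, ← Nat.add_sub_cancel' hlt.le, pow_add, Nat.add_sub_cancel_left]
      ring

section PowKer

variable {H : Type*} [AddCommGroup H] [Module ℂ H] (T : H →ₗ.[ℂ] H) (μ : ℂ)

theorem powKer_mono : Monotone (powKer T μ) := by
  refine monotone_nat_of_le_succ fun n => ?_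
  induction n with
  | zero => exact bot_le
  | succ n ih => exact Submodule.map_mono (Submodule.comap_mono ih)

theorem rank_powKer_succ_le (n : ℕ) : Module.rank ℂ (powKer T μ (n + 1)) ≤
    Module.rank ℂ (powKer T μ n) + Module.rank ℂ (powKer T μ 1) := by
  set A : T.domain →ₗ[ℂ] H := T.toFun - μ • T.domain.subtype
  let φ : (powKer T μ n).comap A →ₗ[ℂ] powKer T μ n := A.restrict fun _ hx => hx
  have hmem : ∀ v : LinearMap.ker φ, ((v : (powKer T μ n).comap A) : H) ∈ powKer T μ 1 :=
    fun v => ⟨v, congrArg Subtype.val (LinearMap.mem_ker.1 v.2), rfl⟩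
  let ι : LinearMap.ker φ →ₗ[ℂ] powKer T μ 1 :=
    (T.domain.subtype ∘ₗ Submodule.subtype _ ∘ₗ Submodule.subtype _).codRestrict _ hmem
  have hι : Function.Injective ι := fun v w hvw =>
    Subtype.ext (Subtype.ext (Subtype.ext (congrArg Subtype.val (a₁ := ι v) (a₂ := ι w) hvw)))
  calc Module.rank ℂ (powKer T μ (n + 1)) ≤ Module.rank ℂ ((powKer T μ n).comap A) :=
        rank_map_le _ _
    _ = Module.rank ℂ (LinearMap.range φ) + Module.rank ℂ (LinearMap.ker φ) :=
        (LinearMap.rank_range_add_rank_ker φ).symm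
    _ ≤ _ := add_le_add (Submodule.rank_le _) (LinearMap.rank_le_of_injective ι hι)

theorem rank_powKer_le (h : Module.rank ℂ (powKer T μ 1) ≤ 1) (n : ℕ) :
    Module.rank ℂ (powKer T μ n) ≤ n := by
  induction n with
  | zero =>
    change Module.rank ℂ (⊥ : Submodule ℂ H) ≤ _
    simp
  | succ n ih =>
    push_cast
    exact (rank_powKer_succ_le T μ n).trans (add_le_add ih h)

theorem powKer_eq_bot (h : powKer T μ 1 = ⊥) (n : ℕ) : powKer T μ n = ⊥ := by
  induction n with
  | zero => rfl
  | succ n ih => exact (congrArg (fun K => Submodule.map _ (Submodule.comap _ K)) ih).trans h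

theorem algMultiplicity_eq_zero (h : powKer T μ 1 = ⊥) : algMultiplicity T μ = 0 := by
  have hroot : rootSpace T μ = ⊥ := by simp [rootSpace, powKer_eq_bot T μ h]
  rw [algMultiplicity, hroot]
  simp

theorem algMultiplicity_le {N : ℕ∞} (h₁ : Module.rank ℂ (powKer T μ 1) ≤ 1)
    (hN : ∀ (n : ℕ) (u : H), u ∈ powKer T μ (n + 1) → u ∉ powKer T μ n → ((n + 1 : ℕ) : ℕ∞) ≤ N) :
    algMultiplicity T μ ≤ N := by
  rcases eq_or_ne N ⊤ with rfl | hN'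
  · exact le_top
  lift N to ℕ using hN'
  have hstab : ∀ n, powKer T μ n ≤ powKer T μ N := by
    intro n
    rcases le_total n N with hn | hn
    · exact powKer_mono T μ hn
    induction n, hn using Nat.le_induction with
    | base => exact le_rfl
    | succ n hn ih =>
      refine le_trans (fun u hu => ?_) ih
      by_contra hu0
      exact absurd (Nat.cast_le.1 (hN n u hu hu0)) (by omega)
  rw [algMultiplicity, Cardinal.toENat_le_natCast]
  exact (Submodule.rank_mono (iSup_le hstab)).trans (rank_powKer_le T μ h₁ N)

end PowKer

section SchrodingerOperator

variable {V : ℝ → ℂ} {μ : ℂ} {u : HalfLineL2}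

theorem mem_powKer_succ {n : ℕ} : u ∈ powKer (schrodingerOperator V) μ (n + 1) ↔
    ∃ f, IsDirichletPair V u f ∧ f - μ • u ∈ powKer (schrodingerOperator V) μ n := by
  constructor
  · rintro ⟨x, hx, rfl⟩
    exact ⟨schrodingerOperator V x,
      (schrodingerOperator_graph V).le (LinearPMap.mem_graph _ x), hx⟩
  · rintro ⟨f, huf, hf⟩
    have hgraph : (u, f) ∈ (schrodingerOperator V).graph := (schrodingerOperator_graph V).ge huf
    obtain ⟨x, rfl, rfl⟩ := (LinearPMap.mem_graph_iff _).1 hgraph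
    exact ⟨x, hf, rfl⟩

theorem mem_powKer_one :
    u ∈ powKer (schrodingerOperator V) μ 1 ↔ IsDirichletPair V u (μ • u) := by
  rw [mem_powKer_succ (n := 0)]
  simp only [powKer, Submodule.mem_bot, sub_eq_zero, exists_eq_right]

end SchrodingerOperator

namespace ExpIntegrable

variable {V : ℝ → ℂ} {a : ℝ} {μ k : ℂ}

theorem rank_powKer_one_le (hV : ExpIntegrable V a) (ha : 0 < a) (μ : ℂ) :
    Module.rank ℂ (powKer (schrodingerOperator V) μ 1) ≤ 1 := by
  refine (rank_submodule_le_one_iff' _).2 ?_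
  rcases eq_or_ne (powKer (schrodingerOperator V) μ 1) ⊥ with hbot | hbot
  · exact ⟨0, by simp [hbot]⟩
  obtain ⟨u, hu, hu0⟩ := Submodule.exists_mem_ne_zero_of_ne_bot hbot
  exact ⟨u, fun v hv => Submodule.mem_span_singleton.2
    (hV.exists_smul_eq_of_eigenvector ha (mem_powKer_one.1 hu) (mem_powKer_one.1 hv) hu0)⟩

-- Each step down the chain of root vectors multiplies the pairing with `e(·, k)` by `k² - μ`, up to
-- a multiple of the Jost function, by Green's identity.
theorem exists_pow_mul_jostPairing_eq (hV : ExpIntegrable V a) (ha : 0 < a) (n : ℕ) {u : HalfLineL2}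
    (hu : u ∈ powKer (schrodingerOperator V) μ (n + 1))
    (hu0 : u ∉ powKer (schrodingerOperator V) μ n) :
    ∃ p : ℂ → ℂ, Continuous p ∧ p μ ≠ 0 ∧ ∀ k : ℂ, 0 < k.im →
      (k ^ 2 - μ) ^ (n + 1) * jostPairing V u k = jostFunction V k * p (k ^ 2) := by
  induction n generalizing u with
  | zero =>
    obtain ⟨d, hd0, hd⟩ := hV.exists_jostPairing_eq_of_eigenvector ha (mem_powKer_one.1 hu)
      fun h => hu0 (h ▸ Submodule.zero_mem _)
    refine ⟨fun _ => d, continuous_const, hd0, fun k hk => ?_⟩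
    linear_combination hd k hk
  | succ n ih =>
    obtain ⟨f, huf, hf⟩ := mem_powKer_succ.1 hu
    obtain ⟨d, hd⟩ := hV.exists_jostPairing_eq ha huf
    obtain ⟨p, hpc, hp0, hp⟩ := ih hf fun hf' => hu0 (mem_powKer_succ.2 ⟨f, huf, hf'⟩)
    refine ⟨fun s => p s - d * (s - μ) ^ (n + 1), by fun_prop, by simpa using hp0, fun k hk => ?_⟩
    have hstep := hp k hk
    rw [hV.jostPairing_sub ha hk, jostPairing_smul] at hstep
    linear_combination hstep - (k ^ 2 - μ) ^ (n + 1) * hd k hk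

theorem le_analyticOrderAt_jostFunction (hV : ExpIntegrable V a) (ha : 0 < a) (hk : 0 < k.im)
    {n : ℕ} {u : HalfLineL2} (hu : u ∈ powKer (schrodingerOperator V) (k ^ 2) (n + 1))
    (hu0 : u ∉ powKer (schrodingerOperator V) (k ^ 2) n) :
    ((n + 1 : ℕ) : ℕ∞) ≤ analyticOrderAt (jostFunction V) k := by
  obtain ⟨p, hpc, hp0, hp⟩ := hV.exists_pow_mul_jostPairing_eq ha n hu hu0
  obtain ⟨B, hB⟩ := hV.exists_norm_jostPairing_le ha u (half_pos hk)
  refine natCast_le_analyticOrderAt_of_isBigO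
    (hV.analyticOnNhd_jostFunction ha k (show -(2 * k.im) < a by linarith)) ?_
  have hp0' : ∀ᶠ w : ℂ in 𝓝 k, p (w ^ 2) ≠ 0 :=
    (hpc.comp (continuous_pow 2)).continuousAt.eventually_ne hp0
  have him : ∀ᶠ w : ℂ in 𝓝 k, k.im / 2 < w.im :=
    (Complex.continuous_im.tendsto k).eventually (lt_mem_nhds (half_lt_self hk))
  have hpairing : jostPairing V u =O[𝓝 k] fun _ => (1 : ℂ) := by
    refine .of_bound B ?_
    filter_upwards [him] with w hw
    simpa using hB w hw.le
  have hcont : (fun w => (w + k) ^ (n + 1) * (p (w ^ 2))⁻¹) =O[𝓝 k] fun _ => (1 : ℂ) :=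
    (ContinuousAt.mul (by fun_prop)
      ((hpc.comp (continuous_pow 2)).continuousAt.inv₀ hp0)).tendsto.isBigO_one ℂ
  have hfactor : jostFunction V =ᶠ[𝓝 k] fun w =>
      (w + k) ^ (n + 1) * (p (w ^ 2))⁻¹ * jostPairing V u w * (w - k) ^ (n + 1) := by
    filter_upwards [hp0', him] with w hpw hw
    refine mul_right_cancel₀ hpw ((hp w (by linarith)).symm.trans ?_)
    rw [show w ^ 2 - k ^ 2 = (w + k) * (w - k) by ring, mul_pow]
    field_simp
  refine hfactor.trans_isBigO ?_
  simpa using (hcont.mul hpairing).mul (Asymptotics.isBigO_refl (fun w => (w - k) ^ (n + 1)) (𝓝 k))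

theorem algMultiplicity_le_analyticOrderAt (hV : ExpIntegrable V a) (ha : 0 < a) (hk : 0 < k.im) :
    algMultiplicity (schrodingerOperator V) (k ^ 2) ≤ analyticOrderAt (jostFunction V) k :=
  algMultiplicity_le _ _ (hV.rank_powKer_one_le ha _)
    fun _ _ hu hu0 => hV.le_analyticOrderAt_jostFunction ha hk hu hu0

theorem algMultiplicity_eq_zero_of_im_eq_zero (hV : ExpIntegrable V a) (ha : 0 < a)
    (hk : k.im = 0) : algMultiplicity (schrodingerOperator V) (k ^ 2) = 0 :=
  algMultiplicity_eq_zero _ _ <| (Submodule.eq_bot_iff _).2 fun _ hu =>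
    hV.eq_zero_of_isDirichletPair_of_im_eq_zero ha hk (mem_powKer_one.1 hu)

end ExpIntegrable

/-! ### Counting zeros by Jensen's formula -/

theorem tsum_analyticOrderAt_eq_finsum_divisor {f : ℂ → ℂ} {K : Set ℂ} (hK : IsCompact K)
    (hf : AnalyticOnNhd ℂ f K) (hfin : ∀ z ∈ K, analyticOrderAt f z ≠ ⊤) :
    ∑' z : K, (analyticOrderAt f z : ℝ≥0∞) =
      ENNReal.ofReal ((∑ᶠ z, MeromorphicOn.divisor f K z : ℤ) : ℝ) := by
  set D := MeromorphicOn.divisor f K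
  have hD : ∀ z, K.indicator (fun z => (analyticOrderAt f z : ℝ≥0∞)) z = ENNReal.ofReal (D z) := by
    intro z
    by_cases hz : z ∈ K
    · obtain ⟨m, hm⟩ := ENat.ne_top_iff_exists.1 (hfin z hz)
      rw [indicator_of_mem hz, MeromorphicOn.AnalyticOnNhd.divisor_apply hf hz, ← hm]
      simp
    · simp [D, hz]
  have hsupp := D.finiteSupport hK
  rw [tsum_subtype K fun z => (analyticOrderAt f z : ℝ≥0∞), tsum_congr hD,
    finsum_eq_sum_of_support_subset (s := hsupp.toFinset) _ (by simp), Int.cast_sum,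
    ENNReal.ofReal_sum_of_nonneg fun z _ =>
      Int.cast_nonneg (MeromorphicOn.AnalyticOnNhd.divisor_nonneg hf z)]
  refine tsum_eq_sum fun z hz => ?_
  have hDz : D z = 0 := by simpa using hz
  simp [hDz]

theorem tsum_analyticOrderAt_closedBall_le {f : ℂ → ℂ} {c : ℂ} {r R M : ℝ} (hr : 0 < r)
    (hrR : r < R) (hM : 1 ≤ M) (hf : AnalyticOnNhd ℂ f (Metric.closedBall c R)) (hc : f c ≠ 0)
    (hbound : ∀ z ∈ Metric.sphere c R, ‖f z‖ ≤ M) :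
    ∑' z : Metric.closedBall c r, (analyticOrderAt f z : ℝ≥0∞) ≤
      ENNReal.ofReal (Real.log (M / ‖f c‖) / Real.log (R / r)) := by
  have hfr : AnalyticOnNhd ℂ f (Metric.closedBall c r) :=
    hf.mono (Metric.closedBall_subset_closedBall hrR.le)
  have hcr : c ∈ Metric.closedBall c r := Metric.mem_closedBall_self hr.le
  have hfin : ∀ z ∈ Metric.closedBall c r, analyticOrderAt f z ≠ ⊤ := by
    refine fun z hz => hfr.analyticOrderAt_ne_top_of_isPreconnected
      (convex_closedBall c r).isPreconnected hcr hz ?_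
    simp [(hfr c hcr).analyticOrderAt_eq_zero.2 hc]
  rw [tsum_analyticOrderAt_eq_finsum_divisor (isCompact_closedBall c r) hfr hfin]
  refine ENNReal.ofReal_le_ofReal ?_
  have hrabs : |r| = r := abs_of_pos hr
  have hRabs : |R| = R := abs_of_pos (hr.trans hrR)
  have hJensen := AnalyticOnNhd.sum_divisor_le (c := c) (R := R) (f := f) (by rwa [hrabs])
    (by rwa [hrabs, hRabs]) hM (by rwa [hRabs]) hc (by rwa [hRabs])
  rwa [hrabs] at hJensen

theorem exists_sq_eq_im_nonneg (μ : ℂ) : ∃ k : ℂ, k ^ 2 = μ ∧ 0 ≤ k.im := by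
  obtain ⟨z, hz⟩ := IsAlgClosed.exists_pow_nat_eq μ two_pos
  rcases le_total 0 z.im with h | h
  · exact ⟨z, hz, h⟩
  · exact ⟨-z, by rw [neg_sq, hz], by simpa using h⟩

theorem mem_closedBall_of_im_nonneg {k : ℂ} {b : ℝ} (hk : 0 ≤ k.im) (hkb : ‖k‖ ≤ b) :
    k ∈ Metric.closedBall (2 * b * Complex.I) (√5 * b) := by
  have hb : 0 ≤ b := (norm_nonneg k).trans hkb
  have hsq : ‖k - 2 * b * Complex.I‖ ^ 2 = ‖k‖ ^ 2 - 4 * b * k.im + 4 * b ^ 2 := by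
    have hre : (k - 2 * b * Complex.I).re = k.re := by simp
    have him : (k - 2 * b * Complex.I).im = k.im - 2 * b := by simp
    rw [← Complex.normSq_eq_norm_sq, ← Complex.normSq_eq_norm_sq, Complex.normSq_apply,
      Complex.normSq_apply, hre, him]
    ring
  rw [mem_closedBall_iff_norm]
  refine le_of_sq_le_sq ?_ (by positivity)
  rw [hsq, mul_pow, Real.sq_sqrt (by norm_num)]
  nlinarith [mul_nonneg hb hk, norm_nonneg k]

theorem neg_two_mul_im_le_of_mem_closedBall {k : ℂ} {b : ℝ}
    (hk : k ∈ Metric.closedBall (2 * b * Complex.I) (499 / 200 * b)) :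
    -(2 * k.im) ≤ 99 / 100 * b := by
  have him : (k - 2 * b * Complex.I).im = k.im - 2 * b := by simp
  have habs := (Complex.abs_im_le_norm (k - 2 * b * Complex.I)).trans (mem_closedBall_iff_norm.1 hk)
  rw [him] at habs
  linarith [neg_abs_le (k.im - 2 * b)]

theorem log_exp_div_le {A y : ℝ} (hy : 1 / 2 ≤ y) : Real.log (Real.exp A / y) ≤ A + 1 := by
  have hlog : Real.log (1 / 2) ≤ Real.log y := Real.log_le_log (by norm_num) hy
  rw [one_div, Real.log_inv] at hlog
  rw [Real.log_div (Real.exp_pos _).ne' (by linarith), Real.log_exp]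
  linarith [Real.log_le_sub_one_of_pos two_pos]

-- With outer radius `ρ b`, the final estimate needs `1 / (ρ - 2) ≤ 20 log (ρ / √5)`, and
-- `ρ < 5 / 2` keeps the disc inside the half-plane of analyticity.
theorem le_log_div_sqrt_five : (51 / 500 : ℝ) ≤ Real.log (499 / 200 / √5) := by
  have hsqrt : √5 ≤ 2.24 := by
    rw [Real.sqrt_le_left (by norm_num)]
    norm_num
  have hlog := Real.one_sub_inv_le_log_of_pos (show (0 : ℝ) < 499 / 200 / √5 by positivity)
  rw [inv_div] at hlog
  linarith

namespace ExpIntegrable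

variable {V : ℝ → ℂ} {b τ : ℝ} {k : ℂ}

theorem tsum_algMultiplicity_le (hV : ExpIntegrable V τ) (hτ : 0 < τ) :
    ∑' μ : ℂ, (algMultiplicity (schrodingerOperator V) μ : ℝ≥0∞) ≤
      ∑' k : {k : ℂ | 0 < k.im}, (analyticOrderAt (jostFunction V) k : ℝ≥0∞) := by
  choose s hs hs0 using exists_sq_eq_im_nonneg
  have hinj : Function.Injective s := fun μ ν h => by rw [← hs μ, ← hs ν, h]
  rw [tsum_subtype {k : ℂ | 0 < k.im} fun k => (analyticOrderAt (jostFunction V) k : ℝ≥0∞)]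
  refine (ENNReal.tsum_le_tsum fun μ => ?_).trans (ENNReal.tsum_comp_le_tsum_of_injective hinj _)
  rcases (hs0 μ).lt_or_eq with (him : s μ ∈ {k : ℂ | 0 < k.im}) | him
  · rw [indicator_of_mem him, ENat.toENNReal_le]
    simpa only [hs μ] using hV.algMultiplicity_le_analyticOrderAt hτ him
  · have hzero := hV.algMultiplicity_eq_zero_of_im_eq_zero hτ him.symm
    rw [hs μ] at hzero
    simp [hzero]

theorem totalMultiplicity_le (hV : ExpIntegrable V τ) (hτ : 0 < τ) :
    totalMultiplicity V ≤
      ∑' k : {k : ℂ | 0 ≤ k.im}, (analyticOrderAt (jostFunction V) k : ℝ≥0∞) := by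
  have hunion : {k : ℂ | 0 ≤ k.im} = {k : ℂ | 0 < k.im} ∪ range ((↑) : ℝ → ℂ) := by
    ext k
    simp [le_iff_lt_or_eq, Complex.ext_iff, eq_comm]
  have hdisj : Disjoint {k : ℂ | 0 < k.im} (range ((↑) : ℝ → ℂ)) :=
    disjoint_left.2 fun k hk ⟨x, hx⟩ => by simp [← hx] at hk
  rw [hunion, ENNReal.summable.tsum_union_disjoint
      (f := fun k => (analyticOrderAt (jostFunction V) k : ℝ≥0∞)) hdisj ENNReal.summable,
    tsum_range (fun k => (analyticOrderAt (jostFunction V) k : ℝ≥0∞)) Complex.ofReal_injective]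
  exact add_le_add_left (hV.tsum_algMultiplicity_le hτ) _

theorem kernelBound_of_ne_zero (hV : ExpIntegrable V τ) (hτ : 0 ≤ τ) (hk : k ≠ 0)
    (hkτ : -(2 * k.im) ≤ τ) : KernelBound V k ‖k‖⁻¹ τ :=
  ⟨hτ, fun _ ht => norm_jostKernel_le_inv_norm_mul_exp hk hτ hkτ ht, hV⟩

theorem norm_jostFunction_sub_one_le (hV : ExpIntegrable V 0) (hk : k ≠ 0) (hk0 : 0 ≤ k.im) :
    ‖jostFunction V k - 1‖ ≤ Real.exp (‖k‖⁻¹ * ∫ x in Ioi 0, ‖V x‖) - 1 := by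
  have hbound := (hV.kernelBound_of_ne_zero le_rfl hk
    (by linarith)).norm_jostAmplitude_sub_one_le le_rfl
  simpa [jostFunction_eq_jostAmplitude, expTail] using hbound

theorem norm_le_of_jostFunction_eq_zero (hV : ExpIntegrable V 0)
    (hb : ∫ x in Ioi 0, ‖V x‖ ≤ b * Real.log 2) (hk0 : 0 ≤ k.im) (hk : jostFunction V k = 0) :
    ‖k‖ ≤ b := by
  by_contra! hlt
  have hb0 : 0 ≤ b := nonneg_of_mul_nonneg_left
    ((integral_nonneg fun x => norm_nonneg (V x)).trans hb) (Real.log_pos one_lt_two)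
  have hpos : 0 < ‖k‖ := hb0.trans_lt hlt
  have hlog : ‖k‖⁻¹ * ∫ x in Ioi 0, ‖V x‖ < Real.log 2 := by
    rw [inv_mul_lt_iff₀ hpos]
    exact hb.trans_lt (mul_lt_mul_of_pos_right hlt (Real.log_pos one_lt_two))
  have hexp := (Real.lt_log_iff_exp_lt two_pos).1 hlog
  have hone := hV.norm_jostFunction_sub_one_le (norm_pos_iff.1 hpos) hk0
  simp only [hk, zero_sub, norm_neg, norm_one] at hone
  linarith

theorem tsum_analyticOrderAt_le_tsum_closedBall (hV : ExpIntegrable V 0)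
    (hb : ∫ x in Ioi 0, ‖V x‖ ≤ b * Real.log 2) :
    ∑' k : {k : ℂ | 0 ≤ k.im}, (analyticOrderAt (jostFunction V) k : ℝ≥0∞) ≤
      ∑' k : Metric.closedBall (2 * b * Complex.I) (√5 * b),
        (analyticOrderAt (jostFunction V) k : ℝ≥0∞) := by
  rw [tsum_subtype {k : ℂ | 0 ≤ k.im} fun k => (analyticOrderAt (jostFunction V) k : ℝ≥0∞),
    tsum_subtype _ fun k => (analyticOrderAt (jostFunction V) k : ℝ≥0∞)]
  refine ENNReal.tsum_le_tsum fun k => indicator_le (fun k hk => ?_) k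
  rcases eq_or_ne (analyticOrderAt (jostFunction V) k) 0 with hord | hord
  · simp [hord]
  have hzero := apply_eq_zero_of_analyticOrderAt_ne_zero hord
  rw [indicator_of_mem
    (mem_closedBall_of_im_nonneg hk (hV.norm_le_of_jostFunction_eq_zero hb hk hzero))]

theorem half_le_norm_jostFunction (hV : ExpIntegrable V 0) (hb0 : 0 < b)
    (hb : ∫ x in Ioi 0, ‖V x‖ ≤ b * Real.log 2) :
    1 / 2 ≤ ‖jostFunction V (2 * b * Complex.I)‖ := by
  have hnorm : ‖(2 * b * Complex.I : ℂ)‖ = 2 * b := by simp [abs_of_pos hb0]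
  have hc : (2 * b * Complex.I : ℂ) ≠ 0 := norm_pos_iff.1 (by rw [hnorm]; positivity)
  have hexp : Real.exp ((2 * b)⁻¹ * ∫ x in Ioi 0, ‖V x‖) ≤ √2 := by
    rw [← Real.le_log_iff_exp_le (by positivity), Real.log_sqrt two_pos.le,
      inv_mul_le_iff₀ (by positivity)]
    linarith
  have hone := hV.norm_jostFunction_sub_one_le hc (by simp [hb0.le])
  rw [hnorm] at hone
  have hsqrt : √2 ≤ 3 / 2 := by
    rw [Real.sqrt_le_left (by norm_num)]
    norm_num
  have htriangle := norm_sub_norm_le 1 (1 - jostFunction V (2 * b * Complex.I))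
  rw [sub_sub_cancel, norm_one, norm_sub_rev] at htriangle
  linarith

theorem norm_jostFunction_le_of_mem_sphere (hV : ExpIntegrable V b) (hb0 : 0 < b)
    (hk : k ∈ Metric.sphere (2 * b * Complex.I) (499 / 200 * b)) :
    ‖jostFunction V k‖ ≤ Real.exp (200 / 99 * (expTail V b 0 / b)) := by
  rw [mem_sphere_iff_norm] at hk
  have hnorm : 99 / 200 * b ≤ ‖k‖ := by
    have htriangle := norm_sub_le k (2 * b * Complex.I)
    simp only [hk, norm_mul, Complex.norm_ofNat, Complex.norm_real, Complex.norm_I,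
      Real.norm_of_nonneg hb0.le] at htriangle
    linarith
  have him : -(2 * k.im) ≤ b := by
    linarith [neg_two_mul_im_le_of_mem_closedBall (mem_closedBall_iff_norm.2 hk.le)]
  have hk0 : k ≠ 0 := norm_pos_iff.1 (lt_of_lt_of_le (by positivity) hnorm)
  rw [jostFunction_eq_jostAmplitude]
  refine ((hV.kernelBound_of_ne_zero hb0.le hk0 him).norm_jostAmplitude_le le_rfl).trans ?_
  refine Real.exp_le_exp.2 ?_
  calc ‖k‖⁻¹ * expTail V b 0 ≤ (99 / 200 * b)⁻¹ * expTail V b 0 := by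
        gcongr
        exact expTail_nonneg V b 0
    _ = 200 / 99 * (expTail V b 0 / b) := by field_simp

theorem totalMultiplicity_le_ofReal (hV : ExpIntegrable V b) (hb0 : 0 < b)
    (hb : ∫ x in Ioi 0, ‖V x‖ ≤ b * Real.log 2) :
    totalMultiplicity V ≤ ENNReal.ofReal (10 * (1 + 2 / b * expTail V b 0)) := by
  have hV0 : ExpIntegrable V 0 := hV.mono hb0.le
  have hm : 0 ≤ expTail V b 0 / b := div_nonneg (expTail_nonneg V b 0) hb0.le
  have hsqrt : √5 < 499 / 200 := by
    rw [Real.sqrt_lt' (by norm_num)]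
    norm_num
  have hhalf := hV0.half_le_norm_jostFunction hb0 hb
  have hanalytic : AnalyticOnNhd ℂ (jostFunction V)
      (Metric.closedBall (2 * b * Complex.I) (499 / 200 * b)) :=
    (hV.analyticOnNhd_jostFunction hb0).mono fun k hk =>
      (neg_two_mul_im_le_of_mem_closedBall hk).trans_lt (by linarith)
  have hJensen := tsum_analyticOrderAt_closedBall_le (mul_pos (by positivity) hb0)
    (mul_lt_mul_of_pos_right hsqrt hb0) (Real.one_le_exp (by positivity)) hanalytic
    (norm_pos_iff.1 (by linarith)) fun _ => hV.norm_jostFunction_le_of_mem_sphere hb0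
  refine (hV.totalMultiplicity_le hb0).trans <|
    (hV0.tsum_analyticOrderAt_le_tsum_closedBall hb).trans <|
      hJensen.trans (ENNReal.ofReal_le_ofReal ?_)
  rw [mul_div_mul_right _ _ hb0.ne',
    div_le_iff₀ (lt_of_lt_of_le (by norm_num) le_log_div_sqrt_five)]
  calc Real.log (Real.exp (200 / 99 * (expTail V b 0 / b)) / ‖jostFunction V (2 * b * Complex.I)‖)
      ≤ 200 / 99 * (expTail V b 0 / b) + 1 := log_exp_div_le hhalf
    _ ≤ 10 * (1 + 2 * (expTail V b 0 / b)) * (51 / 500) := by linarith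
    _ ≤ 10 * (1 + 2 * (expTail V b 0 / b)) * Real.log (499 / 200 / √5) := by
        gcongr
        exact le_log_div_sqrt_five
    _ = 10 * (1 + 2 / b * expTail V b 0) * Real.log (499 / 200 / √5) := by ring

end ExpIntegrable

theorem totalMultiplicity_le_of_ae_eq_zero {V : ℝ → ℂ} (hV : V =ᵐ[volume.restrict (Ioi 0)] 0) :
    totalMultiplicity V ≤ 10 := by
  have hexp : ExpIntegrable V 1 :=
    (integrable_zero ℝ ℂ _).congr (hV.mono fun x hx => by simp [hx])
  have hnorm : ∫ x in Ioi 0, ‖V x‖ = 0 :=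
    integral_eq_zero_of_ae (hV.mono fun x hx => by simp [hx])
  have htail : expTail V 1 0 = 0 := integral_eq_zero_of_ae (hV.mono fun x hx => by simp [hx])
  simpa [htail] using hexp.totalMultiplicity_le_ofReal one_pos (by simp [hnorm, Real.log_nonneg])

end HalfLineSchrodinger

theorem corollary2_general (V : ℝ → ℂ) (b : ℝ)
    (hV : IntegrableOn (fun x : ℝ => (Real.exp (b * x) : ℂ) * V x) (Ioi 0))
    (hb : ∫ x in Ioi (0 : ℝ), ‖V x‖ ≤ b * Real.log 2) :
    HalfLineSchrodinger.totalMultiplicity V ≤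
      ENNReal.ofReal (10 * (1 + (2 / b) * ∫ x in Ioi (0 : ℝ), Real.exp (b * x) * ‖V x‖)) := by
  have hb0 : 0 ≤ b := nonneg_of_mul_nonneg_left
    ((integral_nonneg fun x => norm_nonneg (V x)).trans hb) (Real.log_pos one_lt_two)
  have hexp : HalfLineSchrodinger.ExpIntegrable V b := hV
  rcases hb0.eq_or_lt with rfl | hpos
  · have hnorm : ∫ x in Ioi (0 : ℝ), ‖V x‖ = 0 :=
      le_antisymm (by simpa using hb) (integral_nonneg fun x => norm_nonneg (V x))
    have hzero := (integral_eq_zero_iff_of_nonneg (fun x => norm_nonneg (V x))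
      (hexp.integrableOn le_rfl).norm).1 hnorm
    simpa using HalfLineSchrodinger.totalMultiplicity_le_of_ae_eq_zero
      (hzero.mono fun x hx => norm_eq_zero.1 hx)
  · exact hexp.totalMultiplicity_le_ofReal hpos hb

theorem corollary2 (V : ℝ → ℂ) (a b : ℝ)
    (hV : MeasureTheory.IntegrableOn (fun x : ℝ => (Real.exp (a * x) : ℂ) * V x) (Set.Ioi 0))
    (hb : b = (1 / Real.log 2) * ∫ x in Set.Ioi (0 : ℝ), ‖V x‖)
    (hab : b ≤ a) :
    HalfLineSchrodinger.totalMultiplicity V ≤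
      ENNReal.ofReal
        (10 * (1 + (2 / b) * ∫ x in Set.Ioi (0 : ℝ), Real.exp (b * x) * ‖V x‖)) := by
  refine corollary2_general V b (HalfLineSchrodinger.ExpIntegrable.mono hV hab) ?_
  rw [hb, one_div_mul_eq_div, div_mul_cancel₀ _ (Real.log_pos one_lt_two).ne']
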